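/- **Setting.** Let $d\ge 2$, $n=d-1$, $X=\mathrm{SL}_d(\mathbb R)/\mathrm{SL}_d(\mathbb Z)$ the space of unimodular lattices in $\mathbb R^d$, and $A<\mathrm{SL}_d(\mathbb R)$ the group of diagonal matrices with positive diagonal entries. All norms are supremum norms. For $x\in X$ put $\ell(x)=\min\{\|v\|:0\ne v\in x\}$ and $X^{\ge\delta}=\{x\in X:\ell(x)\ge\delta\}$. Let $\delta_0$ be the supremum of all $\delta$ such that $Ax\cap X^{\ge\delta}\neq\varnothing$ for every $x\in X$. Let $\mathbb R^d_0=\{\mathbf t\in\mathbb R^d:\sum_i t_i=0\}$, with Lebesgue measure induced by the Euclidean structure, let $|\Delta|$ denote the covolume of a lattice $\Delta<\mathbb R^d_0$, let $B_r\subset\mathbb R^d_0$ be the closed ball of radius $r$ about $0$, and let $a(\mathbf t)=\mathrm{diag}(e^{t_1},\dots,e^{t_d})$. *Simplex sets.* A simplex set is a spanning set $\Phi\subset\mathbb R^d_0$ of cardinality $d$ with $\sum_{\mathbf t\in\Phi}\mathbf t=0$; put $\Delta_\Phi=\mathrm{span}_{\mathbb Z}\Phi$ and $\xi_\Phi=\max_{\mathbf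 t\in\Phi}\max_i t_i$. Let $\mathbf b_j\in\mathbb R^d_0$ be the vector with $j$-th coordinate $-n$ and all other coordinates $1$, and $\Phi_*=\{\mathbf b_1,\dots,\mathbf b_d\}$. A distortion map of $\Phi$ is a linear automorphism $h$ of $\mathbb R^d_0$ with $h\Phi_*=|\Delta_\Phi|^{-1/n}\Phi$. For a permutation matrix $\tau$ in the group $\mathscr S$ of all $d\times d$ permutation matrices put $\mathbf w_\tau=|\Delta_\Phi|^{1/n}\,h\,\tau\bigl(d^{-1}\sum_{l=1}^d(l-1)\mathbf b_l\bigr)$. Let $\theta\in\mathscr S$ be the standard $d$-cycle, $\theta\mathbf e_i=\mathbf e_{i+1\bmod d}$; for a set $\mathscr S'$ of representatives of $\mathscr S/\langle\theta\rangle$ put $\mathbf W'_\Phi=\{\mathbf w_\tau:\tau\in\mathscr S'\}$. *Compact orbits.* Let $\Omega$ be the set of $x\in X$ with $Ax$ compact. For $x\in\Omega$ let $\Delta_x\subset\mathbb R^d_0$ be the set of all $(\log|a_1|,\dots,\log|a_d|)$, where $\mathrm{diag}(a_1,\dots,a_d)$ runs over the diagonal matrices of determinant $\pm1$ that map the lattice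 $x$ onto itself. A simplex set $\Phi\subset\Delta_x$ is $M$-tight for $x$ if $\ell(x)\le Me^{-\frac n2\xi_\Phi}$. A shape is a lattice in $\mathbb R^d_0$ up to homothety; the space of shapes has the quotient topology from the space of bases of $\mathbb R^d_0$. For a compact set $K$ of shapes, $\Omega_{M,K}$ is the set of $x\in\Omega$ that possess an $M$-tight simplex set $\Phi$ for which the shape of $\Delta_\Phi$ is in $K$. **Theorem.** Fix $M>1$, a compact set $K$ of shapes, $\delta_1\in(0,\delta_0)$, $\kappa\in(0,1)$ and $c>0$. There is a finite set of $A$-orbits such that the following holds for every $x\in\Omega_{M,K}$ that lies on none of them, every $M$-tight simplex set $\Phi\subset\Delta_x$ for $x$, every distortion map $h$ of $\Phi$ and every set $\mathscr S'$ of representatives of $\mathscr S/\langle\theta\rangle$. Put $r=c\,|\Delta_x|^{\kappa/n}$ and $$\mathbf W''_\Phi=\{\mathbf w\in\mathbf W'_\Phi:\ \exists\,\mathbf t\in\mathbf w+B_r,\ a(\mathbf t)x\in X^{\ge\delta_1}\}.$$ Then: 1. the index $[\Delta_x:\Delta_\Phi]$ is finite, and $[\Delta_x:\Delta_\Phi]\le|\mathbf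 W''_\Phi|\le n!$; 2. if $d$ is prime, then $[\Delta_x:\Delta_\Phi]=1$; 3. if $\mathbf W''_\Phi=\mathbf W'_\Phi$, then $[\Delta_x:\Delta_\Phi]=1$; 4. if $d$ is prime or $\mathbf W''_\Phi=\mathbf W'_\Phi$, then $Ax\cap X^{\ge\delta_1}$ has at least $|\mathbf W''_\Phi|$ connected components. -/

import Mathlib

open scoped Pointwise

noncomputable section

namespace CompactOrbits

/-! ### The hyperplane of vectors with coordinate sum zero -/

/-- The hyperplane `R^d_0` of vectors in `R^d` with coordinate sum `0`, of dimension `d - 1`.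
It carries the Euclidean structure only in order to have its Lebesgue measure `volume`;
lengths are always measured with the supremum norm, see `supNorm`. -/
def R0 (d : ℕ) : Submodule ℝ (EuclideanSpace ℝ (Fin d)) where
  carrier := {t | ∑ i, t i = 0}
  zero_mem' := by simp
  add_mem' := by
    intro s t hs ht
    simp only [Set.mem_ofPred_eq, PiLp.add_apply, Finset.sum_add_distrib] at *
    rw [hs, ht, add_zero]
  smul_mem' := by
    intro c t ht
    simp only [Set.mem_ofPred_eq, PiLp.smul_apply, smul_eq_mul, ← Finset.mul_sum] at *
    rw [ht, mul_zero]

variable {d : ℕ}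

/-- The `i`-th coordinate of `t`. -/
def coord (t : R0 d) (i : Fin d) : ℝ := (t : EuclideanSpace ℝ (Fin d)) i

/-- Build an element of the hyperplane from its coordinates. -/
def ofCoord (v : Fin d → ℝ) (hv : ∑ i, v i = 0) : R0 d := ⟨WithLp.toLp 2 v, hv⟩

lemma sum_coord (t : R0 d) : ∑ i, coord t i = 0 := t.2

/-- The supremum norm on the hyperplane. -/
def supNorm (t : R0 d) : ℝ := ‖fun i => coord t i‖

/-- The largest coordinate of `t`. -/
def maxCoord (t : R0 d) : ℝ := ⨆ i, coord t i

/-- The closed ball of radius `r` about the origin for the supremum norm. -/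
def ball0 (d : ℕ) (r : ℝ) : Set (R0 d) := {t | supNorm t ≤ r}

/-! ### Simplex sets -/

/-- A simplex set: `d` vectors with sum zero that span the hyperplane. -/
structure IsSimplexSet (Φ : Finset (R0 d)) : Prop where
  card_eq : Φ.card = d
  span_eq_top : Submodule.span ℝ (Φ : Set (R0 d)) = ⊤
  sum_eq_zero : ∑ t ∈ Φ, t = 0

/-- The lattice generated by a simplex set. -/
def latticeOf (Φ : Finset (R0 d)) : Submodule ℤ (R0 d) := Submodule.span ℤ (Φ : Set (R0 d))

/-- The largest coordinate that occurs in the elements of `Φ`. -/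
def xi (Φ : Finset (R0 d)) : ℝ := ⨆ t : Φ, maxCoord (t : R0 d)

/-- The vector `b_j = (1, ..., 1 - d, ..., 1)`, with `1 - d` in the `j`-th place. -/
def stdVec (j : Fin d) : R0 d :=
  ofCoord (fun i => if i = j then 1 - (d : ℝ) else 1) (by
    have h : ∀ i : Fin d, (if i = j then 1 - (d : ℝ) else 1) = 1 - (if i = j then (d : ℝ) else 0) := by
      intro i
      split_ifs <;> simp
    simp [h, Finset.sum_sub_distrib])

/-- The permutation matrix of `τ`, which sends `e_i` to `e_{τ i}`, acting on the hyperplane. -/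
def permAct (τ : Equiv.Perm (Fin d)) (t : R0 d) : R0 d :=
  ofCoord (fun i => coord t (τ.symm i)) (by
    rw [Equiv.sum_comp τ.symm (fun i => coord t i)]
    exact sum_coord t)

/-- A distortion map of `Φ`: a linear automorphism `h` of the hyperplane which maps the
standard simplex set `{b_1, ..., b_d}` onto `|Δ_Φ| ^ (-1/n) • Φ`, where `n = d - 1`. -/
def IsDistortionMap (Φ : Finset (R0 d)) (h : R0 d ≃ₗ[ℝ] R0 d) : Prop :=
  h '' Set.range (stdVec (d := d)) =
    (ZLattice.covolume (latticeOf Φ) ^ (-(1 / ((d - 1 : ℕ) : ℝ)))) • (Φ : Set (R0 d))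

/-- The point `w_τ` of the standard simplex set, `τ (d⁻¹ ∑ (l - 1) b_l)` for `l = 1, ..., d`
(the index `l : Fin d` below already runs from `0` to `d - 1`). -/
def wStd (τ : Equiv.Perm (Fin d)) : R0 d :=
  permAct τ ((d : ℝ)⁻¹ • ∑ l : Fin d, ((l : ℕ) : ℝ) • stdVec l)

/-- The point `w_τ` of the simplex set `Φ` with distortion map `h`. -/
def wPoint (Φ : Finset (R0 d)) (h : R0 d ≃ₗ[ℝ] R0 d) (τ : Equiv.Perm (Fin d)) : R0 d :=
  (ZLattice.covolume (latticeOf Φ) ^ (1 / ((d - 1 : ℕ) : ℝ))) • h (wStd τ)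

/-- `S` is a set of representatives of the left cosets of the group generated by the standard
`d`-cycle `i ↦ i + 1 mod d` in the symmetric group. -/
def IsCosetReps (S : Set (Equiv.Perm (Fin d))) : Prop :=
  ∀ τ : Equiv.Perm (Fin d), ∃! σ, σ ∈ S ∧ σ⁻¹ * τ ∈ Subgroup.zpowers (finRotate d)

/-! ### Shapes of lattices in the hyperplane -/

/-- Bases of the hyperplane (its dimension is `d - 1`), topologized as tuples of vectors. -/
abbrev Frame (d : ℕ) : Type := {b : Fin (d - 1) → R0 d // LinearIndependent ℝ b}

/-- The lattice spanned by a basis. -/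
def Frame.lattice (b : Frame d) : Submodule ℤ (R0 d) := Submodule.span ℤ (Set.range b.1)

/-- Two bases are equivalent if the lattices they span agree up to a homothety. -/
def shapeSetoid (d : ℕ) : Setoid (Frame d) where
  r b b' := ∃ c : ℝ, 0 < c ∧ ∀ v, v ∈ b.lattice ↔ c • v ∈ b'.lattice
  iseqv :=
    { refl := fun b => ⟨1, one_pos, fun v => by rw [one_smul]⟩
      symm := by
        rintro b b' ⟨c, hc, h⟩
        refine ⟨c⁻¹, inv_pos.2 hc, fun v => ?_⟩
        rw [h, smul_smul, mul_inv_cancel₀ hc.ne', one_smul]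
      trans := by
        rintro b b' b'' ⟨c, hc, h⟩ ⟨e, he, h'⟩
        refine ⟨e * c, mul_pos he hc, fun v => ?_⟩
        rw [h, h', smul_smul] }

/-- The space of shapes: lattices in the hyperplane up to homothety, with the quotient topology
from the space of bases. -/
def Shape (d : ℕ) : Type := Quotient (shapeSetoid d)

instance : TopologicalSpace (Shape d) :=
  inferInstanceAs (TopologicalSpace (Quotient (shapeSetoid d)))

/-- The shape of the lattice spanned by a basis. -/
def Frame.shape (b : Frame d) : Shape d := Quotient.mk (shapeSetoid d) b

/-- The lattice `L` has its shape in `K`. -/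
def HasShapeIn (K : Set (Shape d)) (L : Submodule ℤ (R0 d)) : Prop :=
  ∃ b : Frame d, b.lattice = L ∧ b.shape ∈ K

/-! ### The space of unimodular lattices and the diagonal group -/

/-- The image of `SL_d(ℤ)` in `SL_d(ℝ)`. -/
def SLZ (d : ℕ) : Subgroup (Matrix.SpecialLinearGroup (Fin d) ℝ) :=
  (Matrix.SpecialLinearGroup.map (n := Fin d) (Int.castRingHom ℝ)).range

/-- The space `SL_d(ℝ) / SL_d(ℤ)` of unimodular lattices, with the quotient topology. -/
abbrev LatticeSpace (d : ℕ) : Type := Matrix.SpecialLinearGroup (Fin d) ℝ ⧸ SLZ d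

/-- The points `g m`, `m ∈ ℤ^d`, of the lattice which is represented by the coset of `g`. -/
def points (x : LatticeSpace d) : Set (Fin d → ℝ) :=
  {v | ∃ g : Matrix.SpecialLinearGroup (Fin d) ℝ, (g : LatticeSpace d) = x ∧
    ∃ m : Fin d → ℤ, v = g.1.mulVec (fun i => (m i : ℝ))}

/-- The length `ℓ(x)` of a shortest nonzero vector of `x` in the supremum norm. -/
def minLength (x : LatticeSpace d) : ℝ := sInf {r | ∃ v ∈ points x, v ≠ 0 ∧ r = ‖v‖}

/-- The set of unimodular lattices without nonzero vectors shorter than `δ`. -/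
def thick (d : ℕ) (δ : ℝ) : Set (LatticeSpace d) := {x | δ ≤ minLength x}

/-- The group `A` of diagonal matrices of determinant one with positive diagonal entries. -/
def diagA (d : ℕ) : Set (Matrix.SpecialLinearGroup (Fin d) ℝ) :=
  {g | g.1.IsDiag ∧ ∀ i, 0 < g.1 i i}

/-- The orbit `A x`. -/
def orbitA (x : LatticeSpace d) : Set (LatticeSpace d) := (fun g => g • x) '' diagA d

/-- The matrix `a(t) = diag(exp t_1, ..., exp t_d)`. -/
def expDiag (t : R0 d) : Matrix.SpecialLinearGroup (Fin d) ℝ :=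
  ⟨Matrix.diagonal fun i => Real.exp (coord t i), by
    rw [Matrix.det_diagonal, ← Real.exp_sum, sum_coord, Real.exp_zero]⟩

/-- The largest `δ` (as a supremum) such that every `A`-orbit meets `thick d δ`. -/
def deltaZero (d : ℕ) : ℝ := sSup {δ | ∀ x : LatticeSpace d, (orbitA x ∩ thick d δ).Nonempty}

/-- The lattices with compact `A`-orbit. -/
def Omega (d : ℕ) : Set (LatticeSpace d) := {x | IsCompact (orbitA x)}

/-- The stabilizer of the lattice `x` in the group `UA` of all diagonal matrices of
determinant `1` or `-1`; a matrix is given by its diagonal. -/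
def stabUA (x : LatticeSpace d) : Set (Fin d → ℝ) :=
  {a | |∏ i, a i| = 1 ∧ (Matrix.diagonal a).mulVec '' points x = points x}

lemma ne_zero_of_mem_stabUA {x : LatticeSpace d} {a : Fin d → ℝ} (ha : a ∈ stabUA x) (i : Fin d) :
    a i ≠ 0 := by
  intro h
  have h1 := ha.1
  rw [Finset.prod_eq_zero (Finset.mem_univ i) h] at h1
  simp at h1

/-- The group `Δ_x`, the image of `stabUA x` under `diag(a_1, ..., a_d) ↦ (log |a_i|)_i`. -/
def logStab (x : LatticeSpace d) : Submodule ℤ (R0 d) :=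
  AddSubgroup.toIntSubmodule
    { carrier := {t | ∃ a ∈ stabUA x, ∀ i, coord t i = Real.log |a i|}
      zero_mem' := ⟨fun _ => 1, ⟨by simp, by simp⟩, fun i => by simp [coord]⟩
      add_mem' := by
        rintro s t ⟨a, ha, hs⟩ ⟨b, hb, ht⟩
        refine ⟨fun i => a i * b i, ⟨?_, ?_⟩, fun i => ?_⟩
        · rw [Finset.prod_mul_distrib, abs_mul, ha.1, hb.1, one_mul]
        · have h : (Matrix.diagonal fun i => a i * b i).mulVec =
              (Matrix.diagonal a).mulVec ∘ (Matrix.diagonal b).mulVec := by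
            funext v
            simp [Matrix.mulVec_mulVec]
          rw [h, Set.image_comp, hb.2, ha.2]
        · rw [abs_mul, Real.log_mul (abs_ne_zero.2 (ne_zero_of_mem_stabUA ha i))
            (abs_ne_zero.2 (ne_zero_of_mem_stabUA hb i)), ← hs i, ← ht i]
          rfl
      neg_mem' := by
        rintro t ⟨a, ha, ht⟩
        have hne := ne_zero_of_mem_stabUA ha
        refine ⟨fun i => (a i)⁻¹, ⟨?_, ?_⟩, fun i => ?_⟩
        · rw [Finset.prod_inv_distrib, abs_inv, ha.1, inv_one]
        · have h : (Matrix.diagonal fun i => (a i)⁻¹).mulVec ∘ (Matrix.diagonal a).mulVec = id := by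
            funext v
            have h1 : (fun i => (a i)⁻¹ * a i) = fun _ => (1 : ℝ) := by
              funext i
              exact inv_mul_cancel₀ (hne i)
            simp [Matrix.mulVec_mulVec, h1]
          conv_lhs => rw [← ha.2]
          rw [← Set.image_comp, h, Set.image_id]
        · rw [abs_inv, Real.log_inv, ← ht i]
          rfl }

/-- `Φ` is an `M`-tight simplex set for `x`. -/
structure IsTight (M : ℝ) (x : LatticeSpace d) (Φ : Finset (R0 d)) : Prop where
  isSimplexSet : IsSimplexSet Φ
  subset : (Φ : Set (R0 d)) ⊆ logStab x
  minLength_le : minLength x ≤ M * Real.exp (-(((d - 1 : ℕ) : ℝ) / 2) * xi Φ)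

/-- The lattices with compact `A`-orbit that possess an `M`-tight simplex set `Φ` such that the
shape of the lattice generated by `Φ` lies in `K`. -/
def OmegaMK (M : ℝ) (K : Set (Shape d)) : Set (LatticeSpace d) :=
  {x | x ∈ Omega d ∧ ∃ Φ : Finset (R0 d), IsTight M x Φ ∧ HasShapeIn K (latticeOf Φ)}

/-- The radius `r = c |Δ_x| ^ (κ / n)`, where `n = d - 1`. -/
def radius (c κ : ℝ) (x : LatticeSpace d) : ℝ :=
  c * ZLattice.covolume (logStab x) ^ (κ / ((d - 1 : ℕ) : ℝ))

/-- The set `W'_Φ` of the points `w_τ`, `τ ∈ S`. -/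
def W1 (Φ : Finset (R0 d)) (h : R0 d ≃ₗ[ℝ] R0 d) (S : Set (Equiv.Perm (Fin d))) : Set (R0 d) :=
  wPoint Φ h '' S

/-- The set `W''_Φ` of those `w ∈ W'_Φ` for which some time `t ∈ w + B_r` is a visit time
to `thick d δ`. -/
def W2 (Φ : Finset (R0 d)) (h : R0 d ≃ₗ[ℝ] R0 d) (S : Set (Equiv.Perm (Fin d)))
    (x : LatticeSpace d) (r δ : ℝ) : Set (R0 d) :=
  {w | w ∈ W1 Φ h S ∧ ∃ b ∈ ball0 d r, expDiag (w + b) • x ∈ thick d δ}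

/-- The index `[Δ_x : Δ_Φ]` (with the value `0` if it is infinite). -/
def latticeIndex (x : LatticeSpace d) (Φ : Finset (R0 d)) : ℕ :=
  (latticeOf Φ).toAddSubgroup.relIndex (logStab x).toAddSubgroup

end CompactOrbits

end

open CompactOrbits

noncomputable section

namespace CompactOrbits

variable {d : ℕ}

/-! Let `Φ = {t_1, ..., t_d}` be tight, `ξ = xi Φ`, `n = d - 1`, and write a time `s` at which the
orbit visits the thick part as `∑ y_j t_j`. For every `i` it is congruent modulo `Δ_Φ` to `∑ fract
(y_j - y_i) t_j`, all of whose coordinates are at most `ξ ∑_j fract (y_j - y_i)`. Since `x` contains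
a nonzero vector of length `O(exp (-nξ/2))`, a visit forces `∑_j fract (y_j - y_i) ≥ n/2 - O(1/ξ)`
for every `i`. The average of these sums over `i` is at most `n/2`, so the `y_j` are, up to integers
and a common shift, within `O(1/ξ)` of `0, 1/d, ..., n/d` in some order (`exists_perm_near`). The
vectors `t_j` have length `O(ξ)`. Hence `s` lies within a constant `C` of a point `d⁻¹ ∑ π(j) t_j`
modulo `Δ_Φ` (`exists_perm_near_visit`). Modulo `Δ_Φ` these points are exactly those of `W'`.

Visits are periodic under `Δ_x`. Take a tight set whose lattice has shape in `K`: by compactness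
this lattice has a basis of length comparable to some `ρ` and no nonzero vectors much shorter than
`ρ`. Repeated translation by a short period would keep the visits near one point, which is absurd
(`le_norm_of_mem_logStab`). So nonzero vectors of `Δ_x` have length at least a constant times `ρ`,
its covolume is comparable to `ρ ^ n`, and `C ≤ r` while `r` is small compared with `ρ`, provided
that `ρ` is large. Bounded `ρ` leaves only finitely many orbits (`finite_orbits_of_bounded_frame`):
these are the exceptions. The separation of `Δ_x` is then available for every other tight `Φ`
(`exists_finite_forall_isSeparated`).

Translation by `u ∈ Δ_x` carries a visit near `π` to one near some `π'`, and separation turns the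
approximate relation into an exact congruence of `u` with `d⁻¹ ∑ (π'(j) - π(j)) t_j`
(`IsSeparated.exists_perm`). Thus `Δ_x / Δ_Φ` injects into `W''`. If `d` is prime, or if every `π`
is visited, a nontrivial `u` would send a permutation to a vector with two congruent entries, so
`Δ_x = Δ_Φ`. In that case the neighbourhoods of the points of `W''` give disjoint closed pieces of
the orbit, which cut the thick part into clopen sets (`IsSeparated.ncard_le_components`). -/

/-! ### Points and shortest vectors of unimodular lattices -/

lemma mem_SLZ_of_int {h : Matrix.SpecialLinearGroup (Fin d) ℝ} (N : Matrix (Fin d) (Fin d) ℤ)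
    (hN : ∀ i j, h.1 i j = N i j) : h ∈ SLZ d := by
  have hm : h.1 = N.map (Int.castRingHom ℝ) := by ext i j; simp [hN]
  have hdet : N.det = 1 := by
    have h1 := h.2
    rw [hm, ← RingHom.mapMatrix_apply, ← RingHom.map_det] at h1
    simpa using h1
  refine ⟨⟨N, hdet⟩, Subtype.ext ?_⟩
  rw [hm]
  rfl

lemma exists_int_of_mem_SLZ {h : Matrix.SpecialLinearGroup (Fin d) ℝ} (hh : h ∈ SLZ d) :
    ∃ N : Matrix (Fin d) (Fin d) ℤ, ∀ i j, h.1 i j = N i j := by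
  obtain ⟨N, rfl⟩ := hh
  exact ⟨N.1, fun i j => by simp⟩

lemma mulVec_intCast (N : Matrix (Fin d) (Fin d) ℤ) (m : Fin d → ℤ) :
    (N.map (Int.cast : ℤ → ℝ)).mulVec (fun i => (m i : ℝ)) =
      fun i => ((N.mulVec m i : ℤ) : ℝ) := by
  funext i
  simp [Matrix.mulVec, dotProduct]

/-- The points of the coset of `g` are the vectors `g m` with `m` integral. -/
lemma points_mk (g : Matrix.SpecialLinearGroup (Fin d) ℝ) :
    points (g : LatticeSpace d) =
      Set.range fun m : Fin d → ℤ => g.1.mulVec (fun i => (m i : ℝ)) := by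
  ext v
  constructor
  · rintro ⟨g', hg', m, rfl⟩
    have h1 : g⁻¹ * g' ∈ SLZ d := QuotientGroup.eq.1 hg'.symm
    obtain ⟨N, hN⟩ := exists_int_of_mem_SLZ h1
    have hN' : (g⁻¹ * g').1 = N.map (Int.cast : ℤ → ℝ) := by ext i j; simp [hN]
    refine ⟨N.mulVec m, ?_⟩
    have h2 : g'.1 = g.1 * (g⁻¹ * g').1 := by
      rw [← Matrix.SpecialLinearGroup.coe_mul, mul_inv_cancel_left]
    dsimp only
    rw [h2, ← Matrix.mulVec_mulVec, hN', mulVec_intCast]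
  · rintro ⟨m, rfl⟩
    exact ⟨g, rfl, m, rfl⟩

lemma points_smul (h : Matrix.SpecialLinearGroup (Fin d) ℝ) (x : LatticeSpace d) :
    points (h • x) = h.1.mulVec '' points x := by
  induction x using QuotientGroup.induction_on with
  | H g =>
    have : h • (g : LatticeSpace d) = ((h * g : Matrix.SpecialLinearGroup (Fin d) ℝ) : LatticeSpace d) := rfl
    rw [this, points_mk, points_mk, ← Set.range_comp]
    congr 1
    funext m
    simp [Matrix.mulVec_mulVec]

/-- Inclusion suffices because both lattices have covolume one: `h⁻¹ g` is integral of determinant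
one, so its inverse is integral too. -/
lemma mk_eq_mk_of_points_subset {g h : Matrix.SpecialLinearGroup (Fin d) ℝ}
    (hs : points (g : LatticeSpace d) ⊆ points (h : LatticeSpace d)) :
    (g : LatticeSpace d) = h := by
  rw [points_mk, points_mk] at hs
  have h1 : ∀ j, ∃ m : Fin d → ℤ, h.1.mulVec (fun i => (m i : ℝ)) = g.1.col j := by
    intro j
    obtain ⟨m, hm⟩ := hs ⟨Pi.single j 1, rfl⟩
    refine ⟨m, hm.trans ?_⟩
    change g.1.mulVec (fun i => (((Pi.single j 1 : Fin d → ℤ) i : ℤ) : ℝ)) = _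
    have : (fun i => (((Pi.single j 1 : Fin d → ℤ) i : ℤ) : ℝ)) = Pi.single j 1 := by
      funext i
      by_cases hij : i = j <;> simp [hij]
    rw [this, Matrix.mulVec_single_one]
  choose m hm using h1
  have h2 : (h⁻¹ * g).1 = Matrix.of fun i j => (m j i : ℝ) := by
    have h3 : g.1 = h.1 * Matrix.of fun i j => (m j i : ℝ) := by
      ext i j
      have := congrFun (hm j) i
      simp only [Matrix.col_apply] at this
      rw [← this]
      simp [Matrix.mulVec, dotProduct, Matrix.mul_apply]
    rw [Matrix.SpecialLinearGroup.coe_mul, h3, ← Matrix.mul_assoc,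
      ← Matrix.SpecialLinearGroup.coe_mul]
    simp
  refine (QuotientGroup.eq.2 ?_).symm
  exact mem_SLZ_of_int (Matrix.of fun i j => m j i) fun i j => by rw [h2]; simp

lemma points_injective : Function.Injective (points (d := d)) := by
  intro x y hxy
  induction x using QuotientGroup.induction_on with
  | H g =>
    induction y using QuotientGroup.induction_on with
    | H h => exact mk_eq_mk_of_points_subset hxy.subset

lemma add_mem_points {x : LatticeSpace d} {v w : Fin d → ℝ} (hv : v ∈ points x)
    (hw : w ∈ points x) : v + w ∈ points x := by
  induction x using QuotientGroup.induction_on with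
  | H g =>
    rw [points_mk] at *
    obtain ⟨m, rfl⟩ := hv
    obtain ⟨k, rfl⟩ := hw
    refine ⟨m + k, ?_⟩
    dsimp only
    rw [← Matrix.mulVec_add]
    congr 1
    funext i
    simp

lemma zsmul_mem_points {x : LatticeSpace d} {v : Fin d → ℝ} (hv : v ∈ points x) (k : ℤ) :
    (k : ℝ) • v ∈ points x := by
  induction x using QuotientGroup.induction_on with
  | H g =>
    rw [points_mk] at *
    obtain ⟨m, rfl⟩ := hv
    refine ⟨k • m, ?_⟩
    dsimp only
    rw [← Matrix.mulVec_smul]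
    congr 1
    funext i
    simp

lemma zero_mem_points (x : LatticeSpace d) : (0 : Fin d → ℝ) ∈ points x := by
  induction x using QuotientGroup.induction_on with
  | H g =>
    rw [points_mk]
    refine ⟨0, ?_⟩
    have : (fun i => (((0 : Fin d → ℤ) i : ℤ) : ℝ)) = 0 := by funext i; simp
    dsimp only
    rw [this, Matrix.mulVec_zero]

lemma sum_mem_points {x : LatticeSpace d} {ι : Type*} (s : Finset ι) (f : ι → Fin d → ℝ)
    (hf : ∀ i ∈ s, f i ∈ points x) : ∑ i ∈ s, f i ∈ points x := by
  classical
  induction s using Finset.induction_on with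
  | empty => simpa using zero_mem_points x
  | insert a s ha ih =>
    rw [Finset.sum_insert ha]
    exact add_mem_points (hf a (by simp)) (ih fun i hi => hf i (by simp [hi]))

/-- The bounded operator `g⁻¹` sends the nonzero points to nonzero integer vectors, of norm at least
one. -/
lemma exists_pos_le_norm_of_mem_points (x : LatticeSpace d) :
    ∃ ε > 0, ∀ v ∈ points x, v ≠ 0 → ε ≤ ‖v‖ := by
  induction x using QuotientGroup.induction_on with
  | H g =>
    let T : (Fin d → ℝ) →L[ℝ] (Fin d → ℝ) := LinearMap.toContinuousLinearMap (Matrix.mulVecLin (g⁻¹).1)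
    refine ⟨(‖T‖ + 1)⁻¹, by positivity, fun v hv hv0 => ?_⟩
    rw [points_mk] at hv
    obtain ⟨m, rfl⟩ := hv
    have hT : T (g.1.mulVec fun i => (m i : ℝ)) = fun i => (m i : ℝ) := by
      change (g⁻¹).1.mulVec _ = _
      rw [Matrix.mulVec_mulVec, ← Matrix.SpecialLinearGroup.coe_mul]
      simp
    have hm : m ≠ 0 := by
      rintro rfl
      apply hv0
      have : (fun i => (((0 : Fin d → ℤ) i : ℤ) : ℝ)) = 0 := by funext i; simp
      dsimp only
      rw [this, Matrix.mulVec_zero]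
    obtain ⟨i, hi⟩ := Function.ne_iff.1 hm
    have h1 : (1 : ℝ) ≤ ‖fun i => (m i : ℝ)‖ := by
      refine le_trans ?_ (norm_le_pi_norm _ i)
      rw [Real.norm_eq_abs, ← Int.cast_abs]
      exact_mod_cast Int.one_le_abs hi
    rw [← hT] at h1
    have h2 := T.le_opNorm (g.1.mulVec fun i => (m i : ℝ))
    rw [inv_le_iff_one_le_mul₀ (by positivity)]
    nlinarith [norm_nonneg (g.1.mulVec fun i => (m i : ℝ))]

lemma exists_ne_zero_mem_points [NeZero d] (x : LatticeSpace d) : ∃ v ∈ points x, v ≠ 0 := by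
  induction x using QuotientGroup.induction_on with
  | H g =>
    rw [points_mk]
    refine ⟨_, ⟨fun _ => 1, rfl⟩, fun h => ?_⟩
    have h2 := congrArg ((g⁻¹).1.mulVec) h
    dsimp only at h2
    rw [Matrix.mulVec_mulVec, ← Matrix.SpecialLinearGroup.coe_mul] at h2
    simp only [inv_mul_cancel, Matrix.SpecialLinearGroup.coe_one, Matrix.one_mulVec,
      Matrix.mulVec_zero] at h2
    simpa using congrFun h2 0

lemma bddBelow_norms (x : LatticeSpace d) : BddBelow {r | ∃ v ∈ points x, v ≠ 0 ∧ r = ‖v‖} :=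
  ⟨0, by rintro r ⟨v, -, -, rfl⟩; exact norm_nonneg v⟩

lemma minLength_le {x : LatticeSpace d} {v : Fin d → ℝ} (hv : v ∈ points x) (hv0 : v ≠ 0) :
    minLength x ≤ ‖v‖ :=
  csInf_le (bddBelow_norms x) ⟨v, hv, hv0, rfl⟩

lemma exists_norm_lt_of_minLength_lt [NeZero d] {x : LatticeSpace d} {a : ℝ} (h : minLength x < a) :
    ∃ v ∈ points x, v ≠ 0 ∧ ‖v‖ < a := by
  obtain ⟨v, hv, hv0⟩ := exists_ne_zero_mem_points x
  obtain ⟨_, ⟨w, hw, hw0, rfl⟩, hlt⟩ := exists_lt_of_csInf_lt (s := {r | ∃ v ∈ points x, v ≠ 0 ∧ r = ‖v‖})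
    ⟨_, v, hv, hv0, rfl⟩ h
  exact ⟨w, hw, hw0, hlt⟩

/-! ### The flow -/

lemma coord_add (s t : R0 d) (i : Fin d) : coord (s + t) i = coord s i + coord t i := rfl
lemma coord_sub (s t : R0 d) (i : Fin d) : coord (s - t) i = coord s i - coord t i := rfl
lemma coord_neg (t : R0 d) (i : Fin d) : coord (-t) i = -coord t i := rfl
lemma coord_zero (i : Fin d) : coord (0 : R0 d) i = 0 := rfl
lemma coord_smul (c : ℝ) (t : R0 d) (i : Fin d) : coord (c • t) i = c * coord t i := rfl
lemma coord_ofCoord (v : Fin d → ℝ) (hv : ∑ i, v i = 0) (i : Fin d) : coord (ofCoord v hv) i = v i := rfl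

/-- The `i`-th coordinate as a linear form. -/
def coordₗ (i : Fin d) : R0 d →ₗ[ℝ] ℝ where
  toFun t := coord t i
  map_add' s t := coord_add s t i
  map_smul' c t := coord_smul c t i

lemma coord_sum {ι : Type*} (s : Finset ι) (f : ι → R0 d) (i : Fin d) :
    coord (∑ j ∈ s, f j) i = ∑ j ∈ s, coord (f j) i := map_sum (coordₗ i) f s

@[ext] lemma R0_ext {s t : R0 d} (h : ∀ i, coord s i = coord t i) : s = t :=
  Subtype.ext (PiLp.ext h)

lemma continuous_coord (i : Fin d) : Continuous fun t : R0 d => coord t i :=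
  (coordₗ i).continuous_of_finiteDimensional

lemma abs_coord_le_norm (t : R0 d) (i : Fin d) : |coord t i| ≤ ‖t‖ :=
  PiLp.norm_apply_le (t : EuclideanSpace ℝ (Fin d)) i

lemma supNorm_le_norm (t : R0 d) : supNorm t ≤ ‖t‖ :=
  (pi_norm_le_iff_of_nonneg (norm_nonneg _)).2 fun i => abs_coord_le_norm t i

lemma abs_coord_le_supNorm (t : R0 d) (i : Fin d) : |coord t i| ≤ supNorm t :=
  norm_le_pi_norm (fun i => coord t i) i

lemma norm_le_of_abs_coord_le {t : R0 d} {r : ℝ} (hr : 0 ≤ r) (h : ∀ i, |coord t i| ≤ r) :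
    ‖t‖ ≤ d * r := by
  change ‖(t : EuclideanSpace ℝ (Fin d))‖ ≤ _
  rw [EuclideanSpace.norm_eq]
  refine Real.sqrt_le_iff.2 ⟨by positivity, ?_⟩
  calc ∑ i, ‖(t : EuclideanSpace ℝ (Fin d)) i‖ ^ 2 ≤ ∑ _i : Fin d, r ^ 2 :=
        Finset.sum_le_sum fun i _ => pow_le_pow_left₀ (norm_nonneg _) (h i) 2
    _ = d * r ^ 2 := by simp
    _ ≤ (d * r) ^ 2 := by
        rw [mul_pow]
        refine mul_le_mul_of_nonneg_right ?_ (by positivity)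
        rcases Nat.eq_zero_or_pos d with rfl | hd
        · simp
        · have : (1 : ℝ) ≤ d := by exact_mod_cast hd
          nlinarith

lemma norm_le_supNorm (t : R0 d) : ‖t‖ ≤ d * supNorm t :=
  norm_le_of_abs_coord_le (norm_nonneg _) fun i => abs_coord_le_supNorm t i

lemma coord_le_maxCoord (t : R0 d) (i : Fin d) : coord t i ≤ maxCoord t :=
  le_ciSup (Set.finite_range _).bddAbove i

lemma maxCoord_le_xi {Φ : Finset (R0 d)} {t : R0 d} (ht : t ∈ Φ) : maxCoord t ≤ xi Φ :=
  le_ciSup (f := fun t : Φ => maxCoord (t : R0 d)) (Set.finite_range _).bddAbove ⟨t, ht⟩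

lemma coord_le_xi {Φ : Finset (R0 d)} {t : R0 d} (ht : t ∈ Φ) (i : Fin d) : coord t i ≤ xi Φ :=
  (coord_le_maxCoord t i).trans (maxCoord_le_xi ht)

lemma expDiag_mulVec (t : R0 d) (v : Fin d → ℝ) :
    (expDiag t).1.mulVec v = fun i => Real.exp (coord t i) * v i := by
  funext i
  exact Matrix.mulVec_diagonal _ _ _

lemma expDiag_add (s t : R0 d) : expDiag (s + t) = expDiag s * expDiag t := by
  apply Subtype.ext
  rw [Matrix.SpecialLinearGroup.coe_mul]
  simp [expDiag, coord_add, Real.exp_add]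

lemma expDiag_zero : expDiag (0 : R0 d) = 1 := by
  apply Subtype.ext
  simp [expDiag, coord_zero]

lemma continuous_expDiag : Continuous (expDiag (d := d)) := by
  refine Continuous.subtype_mk ?_ _
  refine Continuous.matrix_diagonal ?_
  exact continuous_pi fun i => Real.continuous_exp.comp (continuous_coord i)

lemma expDiag_mem_diagA (t : R0 d) : expDiag t ∈ diagA d :=
  ⟨Matrix.isDiag_diagonal _, fun i => by simp [expDiag, Real.exp_pos]⟩

lemma exists_expDiag_eq {g : Matrix.SpecialLinearGroup (Fin d) ℝ} (hg : g ∈ diagA d) :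
    ∃ t : R0 d, expDiag t = g := by
  have h1 : Matrix.diagonal (fun i => g.1 i i) = g.1 := hg.1.diagonal_diag
  have h2 : ∏ i, g.1 i i = 1 := by
    have := g.2
    rwa [← h1, Matrix.det_diagonal] at this
  refine ⟨ofCoord (fun i => Real.log (g.1 i i)) ?_, Subtype.ext ?_⟩
  · rw [← Real.log_prod fun i _ => (hg.2 i).ne', h2, Real.log_one]
  · simp only [expDiag, coord_ofCoord]
    rw [← h1]
    congr 1
    funext i
    simp [Real.exp_log (hg.2 i)]

lemma orbitA_eq_range (x : LatticeSpace d) : orbitA x = Set.range fun t : R0 d => expDiag t • x := by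
  ext y
  constructor
  · rintro ⟨g, hg, rfl⟩
    obtain ⟨t, rfl⟩ := exists_expDiag_eq hg
    exact ⟨t, rfl⟩
  · rintro ⟨t, rfl⟩
    exact ⟨_, expDiag_mem_diagA t, rfl⟩

lemma orbitA_expDiag_smul (t : R0 d) (x : LatticeSpace d) : orbitA (expDiag t • x) = orbitA x := by
  rw [orbitA_eq_range, orbitA_eq_range]
  ext y
  constructor
  · rintro ⟨s, rfl⟩
    exact ⟨s + t, by simp only [expDiag_add, mul_smul]⟩
  · rintro ⟨s, rfl⟩
    refine ⟨s - t, ?_⟩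
    simp only
    rw [← mul_smul, ← expDiag_add, sub_add_cancel]

/-! ### The logarithmic stabilizer -/

lemma exists_sign_of_mem_logStab {x : LatticeSpace d} {t : R0 d} (ht : t ∈ logStab x) :
    ∃ ε : Fin d → ℝ, (∀ i, |ε i| = 1) ∧
      (fun v i => ε i * Real.exp (coord t i) * v i) '' points x = points x := by
  obtain ⟨a, ha, hat⟩ := ht
  have hne := ne_zero_of_mem_stabUA ha
  refine ⟨fun i => a i / |a i|, fun i => ?_, ?_⟩
  · rw [abs_div, abs_abs, div_self (abs_ne_zero.2 (hne i))]
  · have h1 : (fun v i => a i / |a i| * Real.exp (coord t i) * v i) = (Matrix.diagonal a).mulVec := by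
      funext v i
      rw [Matrix.mulVec_diagonal, hat i, Real.exp_log (abs_pos.2 (hne i)),
        div_mul_cancel₀ _ (abs_ne_zero.2 (hne i))]
    rw [h1, ha.2]

lemma mem_logStab_of_smul_eq {x : LatticeSpace d} {t : R0 d} (h : expDiag t • x = x) :
    t ∈ logStab x := by
  refine ⟨fun i => Real.exp (coord t i), ⟨?_, ?_⟩, fun i => ?_⟩
  · rw [← Real.exp_sum, sum_coord, Real.exp_zero, abs_one]
  · have := points_smul (expDiag t) x
    rw [h] at this
    exact this.symm
  · rw [Real.abs_exp, Real.log_exp]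

lemma sub_mem_logStab_of_smul_eq {x : LatticeSpace d} {s t : R0 d}
    (h : expDiag s • x = expDiag t • x) : s - t ∈ logStab x := by
  apply mem_logStab_of_smul_eq
  have h1 := congrArg (fun y => expDiag (-t) • y) h
  simp only [← mul_smul, ← expDiag_add] at h1
  rw [neg_add_cancel, expDiag_zero, one_smul, neg_add_eq_sub] at h1
  exact h1

/-- An element of `Δ_x` comes from a stabilizing matrix whose entries may be negative, so `expDiag
t` itself need not fix `x`; squaring removes the signs. -/
lemma expDiag_add_self_smul {x : LatticeSpace d} {t : R0 d} (ht : t ∈ logStab x) :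
    expDiag (t + t) • x = x := by
  obtain ⟨ε, hε, h⟩ := exists_sign_of_mem_logStab ht
  apply points_injective
  rw [points_smul]
  conv_rhs => rw [← h]
  conv_rhs => enter [2]; rw [← h]
  rw [← Set.image_comp]
  congr 1
  funext v i
  rw [expDiag_mulVec]
  simp only [Function.comp, coord_add, Real.exp_add]
  have : ε i * ε i = 1 := by rw [← abs_mul_abs_self, hε, one_mul]
  linear_combination (- Real.exp (coord t i) * Real.exp (coord t i) * v i) * this

/-- Sign changes are isometries for the supremum norm. Visit times are therefore periodic under all
of `Δ_x`, and not only under the times that fix `x`. -/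
lemma minLength_smul_add {x : LatticeSpace d} {t : R0 d} (ht : t ∈ logStab x) (s : R0 d) :
    minLength (expDiag (s + t) • x) = minLength (expDiag s • x) := by
  obtain ⟨ε, hε, h⟩ := exists_sign_of_mem_logStab ht
  have hεne : ∀ i, ε i ≠ 0 := fun i h0 => by have := hε i; rw [h0] at this; simp at this
  have hn : ∀ v : Fin d → ℝ, ‖fun i => ε i * v i‖ = ‖v‖ := by
    intro v
    have : ∀ i, ‖ε i * v i‖ = ‖v i‖ := fun i => by
      rw [norm_mul, Real.norm_eq_abs, hε, one_mul]
    refine le_antisymm ?_ ?_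
    · exact (pi_norm_le_iff_of_nonneg (norm_nonneg _)).2 fun i => by
        rw [this]; exact norm_le_pi_norm v i
    · exact (pi_norm_le_iff_of_nonneg (norm_nonneg _)).2 fun i => by
        rw [← this]; exact norm_le_pi_norm (fun i => ε i * v i) i
  have h0 : ∀ v : Fin d → ℝ, (fun i => ε i * v i) ≠ 0 ↔ v ≠ 0 := by
    intro v
    rw [← norm_ne_zero_iff, hn, norm_ne_zero_iff]
  have hp : points (expDiag s • x) = (fun v i => ε i * v i) '' points (expDiag (s + t) • x) := by
    rw [points_smul, points_smul]
    conv_lhs => rw [← h]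
    rw [← Set.image_comp, ← Set.image_comp]
    congr 1
    funext v i
    simp only [Function.comp, expDiag_mulVec, coord_add, Real.exp_add]
    ring
  unfold minLength
  congr 1
  ext r
  rw [hp]
  constructor
  · rintro ⟨v, hv, hv0, rfl⟩
    exact ⟨_, ⟨v, hv, rfl⟩, (h0 v).2 hv0, (hn v).symm⟩
  · rintro ⟨_, ⟨v, hv, rfl⟩, hv0, rfl⟩
    exact ⟨v, hv, (h0 v).1 hv0, hn v⟩

lemma smul_add_mem_thick_iff {x : LatticeSpace d} {t : R0 d} (ht : t ∈ logStab x) (s : R0 d) (δ : ℝ) :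
    expDiag (s + t) • x ∈ thick d δ ↔ expDiag s • x ∈ thick d δ := by
  simp only [thick, Set.mem_ofPred_eq, minLength_smul_add ht]

/-- Every orbit visits `thick d δ` when `δ < deltaZero d`. -/
lemma exists_visit {δ : ℝ} (hδ : 0 < δ) (hδ' : δ < deltaZero d) (x : LatticeSpace d) :
    ∃ s : R0 d, expDiag s • x ∈ thick d δ := by
  -- The real supremum of the empty set is `0` by convention, which `0 < δ < deltaZero d` excludes.
  have hne : {δ | ∀ x : LatticeSpace d, (orbitA x ∩ thick d δ).Nonempty}.Nonempty := by
    by_contra h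
    rw [Set.not_nonempty_iff_eq_empty] at h
    rw [deltaZero, h, Real.sSup_empty] at hδ'
    exact lt_asymm hδ hδ'
  obtain ⟨δ', h, hlt⟩ := exists_lt_of_lt_csSup hne hδ'
  obtain ⟨y, hy, hy'⟩ := h x
  rw [orbitA_eq_range] at hy
  obtain ⟨s, rfl⟩ := hy
  exact ⟨s, hlt.le.trans hy'⟩

/-! ### Almost equidistributed points on the circle -/

lemma sum_perm_lt (π : Equiv.Perm (Fin d)) (i : Fin d) :
    ∑ j, (if π j < π i then (1 : ℝ) else 0) = (π i : ℕ) := by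
  rw [Equiv.sum_comp π fun l => if l < π i then (1 : ℝ) else 0, Finset.sum_boole]
  have : Finset.univ.filter (fun l : Fin d => l < π i) = Finset.Iio (π i) := by ext; simp
  rw [this, Fin.card_Iio]

lemma sum_perm_val (π : Equiv.Perm (Fin d)) :
    ∑ j, ((π j : ℕ) : ℝ) = d * (((d : ℝ) - 1) / 2) := by
  rw [Equiv.sum_comp π fun l => ((l : ℕ) : ℝ), Fin.sum_univ_eq_sum_range (fun l => (l : ℝ)) d]
  have h := Finset.sum_range_id_mul_two d
  have h2 : (∑ i ∈ Finset.range d, (i : ℝ)) * 2 = d * ((d : ℝ) - 1) := by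
    rcases Nat.eq_zero_or_pos d with rfl | hd
    · simp
    · have h' := congrArg (Nat.cast : ℕ → ℝ) h
      push_cast [Nat.cast_sub hd] at h'
      exact h'
  linarith

/-- If the sums of the fractional parts of `y j - y i` over `j` are almost as large as possible
for every base point `i`, then the points `y j` are, up to integers and a common translation,
close to the points `0, 1 / d, ..., (d - 1) / d` in some order. -/
lemma exists_perm_near [NeZero d] (y : Fin d → ℝ) {η : ℝ} (hη : 0 ≤ η)
    (h : ∀ i, ((d : ℝ) - 1) / 2 - η ≤ ∑ j, Int.fract (y j - y i)) :
    ∃ (π : Equiv.Perm (Fin d)) (c : ℝ) (k : Fin d → ℤ),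
      ∀ j, |y j - k j - c - ((π j : ℕ) : ℝ) / d| ≤ η := by
  have hd : (1 : ℝ) ≤ d := by exact_mod_cast NeZero.one_le
  set z : Fin d → ℝ := fun j => Int.fract (y j - y 0) with hz
  -- `π j` is the rank of `z j`, with ties broken by the sort.
  set π : Equiv.Perm (Fin d) := (Tuple.sort z).symm with hπ
  have hmono : ∀ i j, z i < z j → π i < π j := by
    intro i j hij
    by_contra hcon
    have h1 := Tuple.monotone_sort z (not_lt.1 hcon)
    simp only [Function.comp, hπ, Equiv.apply_symm_apply] at h1
    exact absurd hij (not_lt.2 h1)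
  have hfr : ∀ i j, Int.fract (y j - y i) ≤ z j - z i + if π j < π i then (1 : ℝ) else 0 := by
    intro i j
    have h1 : Int.fract (y j - y i) = Int.fract (z j - z i) := by
      have : y j - y i = z j - z i + ((⌊y j - y 0⌋ - ⌊y i - y 0⌋ : ℤ) : ℝ) := by
        simp only [hz, Int.fract]
        push_cast
        ring
      rw [this, Int.fract_add_intCast]
    have hj0 : 0 ≤ z j := Int.fract_nonneg _
    have hi0 : 0 ≤ z i := Int.fract_nonneg _
    have hj1 : z j < 1 := Int.fract_lt_one _
    have hi1 : z i < 1 := Int.fract_lt_one _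
    rw [h1]
    rcases lt_or_ge (z j) (z i) with hlt | hge
    · rw [if_pos (hmono _ _ hlt), ← Int.fract_add_one,
        Int.fract_eq_self.2 ⟨by linarith, by linarith⟩]
    · rw [Int.fract_eq_self.2 ⟨by linarith, by linarith⟩]
      split_ifs <;> linarith
  set Z : ℝ := ∑ j, z j with hZ
  -- `G i` bounds the sum with base point `i` from above. Its average over `i` is exactly `(d - 1) /
  -- 2`, and its deviation from this average is `-d` times the error to be estimated.
  set G : Fin d → ℝ := fun i => Z - d * z i + ((π i : ℕ) : ℝ) with hG
  have hGlow : ∀ i, ((d : ℝ) - 1) / 2 - η ≤ G i := by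
    intro i
    refine (h i).trans ((Finset.sum_le_sum fun j _ => hfr i j).trans (le_of_eq ?_))
    rw [Finset.sum_add_distrib, Finset.sum_sub_distrib, sum_perm_lt]
    simp [hG, hZ]
  have hGsum : ∑ i, G i = d * (((d : ℝ) - 1) / 2) := by
    simp only [hG]
    rw [Finset.sum_add_distrib, Finset.sum_sub_distrib, sum_perm_val, ← Finset.mul_sum, ← hZ]
    simp
  -- No term falls more than `η` below the average, so none can exceed it by more than the total `d
  -- * η`.
  have hGup : ∀ i, G i ≤ ((d : ℝ) - 1) / 2 + d * η := by
    intro i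
    have h1 : ∑ j, (G j - (((d : ℝ) - 1) / 2 - η)) = d * η := by
      rw [Finset.sum_sub_distrib, hGsum]
      simp
    have h2 := Finset.single_le_sum (f := fun j => G j - (((d : ℝ) - 1) / 2 - η))
      (fun j _ => sub_nonneg.2 (hGlow j)) (Finset.mem_univ i)
    rw [h1] at h2
    linarith
  refine ⟨π, y 0 + (Z - ((d : ℝ) - 1) / 2) / d, fun j => ⌊y j - y 0⌋, fun j => ?_⟩
  have h1 : y j - ⌊y j - y 0⌋ - (y 0 + (Z - ((d : ℝ) - 1) / 2) / d) - ((π j : ℕ) : ℝ) / d =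
      (((d : ℝ) - 1) / 2 - G j) / d := by
    have : z j = y j - y 0 - ⌊y j - y 0⌋ := rfl
    simp only [hG]
    rw [this]
    field_simp
    ring
  rw [h1, abs_div, Nat.abs_cast, div_le_iff₀ (by linarith), abs_le]
  constructor
  · nlinarith [hGup j]
  · nlinarith [hGlow j]

/-! ### Visits to the thick part -/

/-- The point `d⁻¹ ∑ m_j t_j`. -/
def simplexPoint (t : Fin d → R0 d) (m : Fin d → ℤ) : R0 d := (d : ℝ)⁻¹ • ∑ j, (m j : ℝ) • t j

lemma simplexPoint_add (t : Fin d → R0 d) (m k : Fin d → ℤ) :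
    simplexPoint t (m + k) = simplexPoint t m + simplexPoint t k := by
  simp [simplexPoint, add_smul, Finset.sum_add_distrib]

lemma simplexPoint_neg (t : Fin d → R0 d) (m : Fin d → ℤ) :
    simplexPoint t (-m) = - simplexPoint t m := by
  simp [simplexPoint]

lemma simplexPoint_sub (t : Fin d → R0 d) (m k : Fin d → ℤ) :
    simplexPoint t (m - k) = simplexPoint t m - simplexPoint t k := by
  rw [sub_eq_add_neg, simplexPoint_add, simplexPoint_neg, sub_eq_add_neg]

/-- The integer vector of a permutation. -/
def permVec (π : Equiv.Perm (Fin d)) (j : Fin d) : ℤ := ((π j : ℕ) : ℤ)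

lemma zspan_le_logStab {M : ℝ} {x : LatticeSpace d} {Φ : Finset (R0 d)} (hΦ : IsTight M x Φ) :
    latticeOf Φ ≤ logStab x :=
  Submodule.span_le.2 hΦ.subset

lemma sum_zsmul_mem_span (t : Fin d → R0 d) (k : Fin d → ℤ) :
    ∑ j, (k j : ℝ) • t j ∈ Submodule.span ℤ (Set.range t) :=
  Submodule.sum_mem _ fun j _ => by
    rw [Int.cast_smul_eq_zsmul]
    exact Submodule.smul_mem _ _ (Submodule.subset_span ⟨j, rfl⟩)

lemma exists_eq_sum_of_span_eq_top {t : Fin d → R0 d}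
    (hspan : Submodule.span ℝ (Set.range t) = ⊤) (s : R0 d) : ∃ y : Fin d → ℝ, ∑ j, y j • t j = s := by
  have : s ∈ Submodule.span ℝ (Set.range t) := by rw [hspan]; trivial
  exact (Submodule.mem_span_range_iff_exists_fun ℝ).1 this

lemma abs_coord_le_of_forall_le {t : R0 d} {ξ : ℝ} (h : ∀ i, coord t i ≤ ξ) (i : Fin d) :
    |coord t i| ≤ d * ξ := by
  have hd : (1 : ℝ) ≤ d := by exact_mod_cast (Fin.pos i)
  have h1 : ∑ j, (ξ - coord t j) = d * ξ := by
    rw [Finset.sum_sub_distrib, sum_coord]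
    simp
  have h2 := Finset.single_le_sum (f := fun j => ξ - coord t j)
    (fun j _ => sub_nonneg.2 (h j)) (Finset.mem_univ i)
  have h3 : 0 ≤ d * ξ := by
    rw [← h1]
    exact Finset.sum_nonneg fun j _ => sub_nonneg.2 (h j)
  have h4 : 0 ≤ ξ := by
    by_contra hneg
    nlinarith
  rw [h1] at h2
  rw [abs_le]
  constructor
  · linarith
  · nlinarith [h i]

/-- The visits to the thick part take place near the points `d⁻¹ ∑ π(j) t_j`, where `π` runs
over the permutations, modulo the lattice spanned by the simplex set `{t_1, ..., t_d}`. -/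
lemma exists_perm_near_visit [NeZero d] {M δ : ℝ} (hM : 0 < M) (hδ : 0 < δ) :
    ∃ C > 0, ∀ (x : LatticeSpace d) (Φ : Finset (R0 d)), IsTight M x Φ →
      ∀ t : Fin d → R0 d, Set.range t = Φ → ∑ j, t j = 0 →
        ∀ s : R0 d, expDiag s • x ∈ thick d δ →
          ∃ (π : Equiv.Perm (Fin d)), ∃ u ∈ latticeOf Φ,
            ‖s - u - simplexPoint t (permVec π)‖ ≤ C := by
  -- The factor `2` leaves room for a vector that is only almost shortest.
  set C₀ : ℝ := max 0 (Real.log (2 * M / δ)) with hC₀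
  have hC₀0 : 0 ≤ C₀ := le_max_left _ _
  refine ⟨d * (d * d) * C₀ + 1, by positivity, ?_⟩
  intro x Φ hΦ t ht hsum s hs
  have htΦ : ∀ j, t j ∈ Φ := fun j => by
    rw [← Finset.mem_coe, ← ht]; exact ⟨j, rfl⟩
  have hL : latticeOf Φ = Submodule.span ℤ (Set.range t) := by rw [latticeOf, ht]
  set ξ := xi Φ with hξ
  have hcoord : ∀ j i, coord (t j) i ≤ ξ := fun j i => coord_le_xi (htΦ j) i
  have habs : ∀ j i, |coord (t j) i| ≤ d * ξ := fun j i => abs_coord_le_of_forall_le (hcoord j) i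
  have hd0 : (0 : ℝ) < d := by exact_mod_cast NeZero.pos d
  have hξ0 : 0 ≤ ξ := by
    have := (abs_nonneg _).trans (habs 0 0)
    by_contra hneg
    nlinarith
  have hnorm : ∀ j, ‖t j‖ ≤ d * (d * ξ) :=
    fun j => norm_le_of_abs_coord_le (by positivity) (habs j)
  obtain ⟨y, hy⟩ := exists_eq_sum_of_span_eq_top (t := t) (by rw [ht]; exact hΦ.isSimplexSet.span_eq_top) s
  -- For `ξ = 0` all `t_j` vanish, which a spanning set allows only when `d = 1`.
  rcases hξ0.eq_or_lt with hξ0 | hξpos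
  · have ht0 : ∀ j, t j = 0 := fun j => by
      have := hnorm j
      rw [← hξ0] at this
      exact norm_le_zero_iff.1 (by simpa using this)
    refine ⟨1, 0, zero_mem _, ?_⟩
    have hs0 : s = 0 := by rw [← hy]; simp [ht0]
    simp [hs0, simplexPoint, ht0]
    positivity
  obtain ⟨v, hv, hv0, hvlt⟩ : ∃ v ∈ points x, v ≠ 0 ∧
      ‖v‖ < 2 * M * Real.exp (-(((d - 1 : ℕ) : ℝ) / 2) * ξ) := by
    apply exists_norm_lt_of_minLength_lt
    refine hΦ.minLength_le.trans_lt ?_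
    have := Real.exp_pos (-(((d - 1 : ℕ) : ℝ) / 2) * xi Φ)
    nlinarith
  have hdc : ((d - 1 : ℕ) : ℝ) = (d : ℝ) - 1 := by
    rw [Nat.cast_sub NeZero.one_le, Nat.cast_one]
  rw [hdc] at hvlt
  -- As the `t_j` sum to zero, the coefficients of `s` matter only up to a common constant; any `y
  -- i` can serve as origin.
  have hshift : ∀ (c : ℝ), ∑ j, (y j - c) • t j = s := by
    intro c
    simp only [sub_smul]
    rw [Finset.sum_sub_distrib, ← Finset.smul_sum, hsum, smul_zero, sub_zero, hy]
  -- Reduce `s` modulo `Δ_Φ` to `s'` with coefficients in `[0, 1)`. At time `s'` the short vector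
  -- `v` grows by a factor of at most `exp (F * ξ)`, yet must reach length `δ`.
  have hkey : ∀ i, ((d : ℝ) - 1) / 2 - C₀ / ξ ≤ ∑ j, Int.fract (y j - y i) := by
    intro i
    set F := ∑ j, Int.fract (y j - y i) with hF
    set u : R0 d := ∑ j, ((⌊y j - y i⌋ : ℤ) : ℝ) • t j with hu
    set s' : R0 d := ∑ j, Int.fract (y j - y i) • t j with hs'
    have hadd : s' + u = s := by
      rw [hs', hu, ← Finset.sum_add_distrib, ← hshift (y i)]
      exact Finset.sum_congr rfl fun j _ => by rw [← add_smul, Int.fract_add_floor]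
    have hul : u ∈ logStab x := by
      apply zspan_le_logStab hΦ
      rw [hL]
      exact sum_zsmul_mem_span t _
    rw [← hadd, smul_add_mem_thick_iff hul] at hs
    have hs'c : ∀ l, coord s' l ≤ F * ξ := by
      intro l
      rw [hs', coord_sum, hF, Finset.sum_mul]
      exact Finset.sum_le_sum fun j _ => by
        rw [coord_smul]
        exact mul_le_mul_of_nonneg_left (hcoord j l) (Int.fract_nonneg _)
    have hmem : (fun l => Real.exp (coord s' l) * v l) ∈ points (expDiag s' • x) := by
      rw [points_smul]
      exact ⟨v, hv, expDiag_mulVec s' v⟩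
    have hne : (fun l => Real.exp (coord s' l) * v l) ≠ 0 := by
      obtain ⟨l, hl⟩ := Function.ne_iff.1 hv0
      exact Function.ne_iff.2 ⟨l, mul_ne_zero (Real.exp_pos _).ne' hl⟩
    have h1 : δ ≤ Real.exp (F * ξ) * ‖v‖ := by
      refine (hs.trans (minLength_le hmem hne)).trans ?_
      refine (pi_norm_le_iff_of_nonneg (by positivity)).2 fun l => ?_
      rw [norm_mul, Real.norm_of_nonneg (Real.exp_pos _).le]
      exact mul_le_mul (Real.exp_le_exp.2 (hs'c l)) (norm_le_pi_norm v l) (norm_nonneg _)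
        (Real.exp_pos _).le
    have h2 : δ ≤ 2 * M * Real.exp ((F - ((d : ℝ) - 1) / 2) * ξ) := by
      refine (h1.trans (mul_le_mul_of_nonneg_left hvlt.le (Real.exp_pos _).le)).trans (le_of_eq ?_)
      rw [mul_left_comm, ← Real.exp_add]
      ring_nf
    have h3 : Real.log δ ≤ Real.log (2 * M) + (F - ((d : ℝ) - 1) / 2) * ξ := by
      rw [← Real.log_exp ((F - ((d : ℝ) - 1) / 2) * ξ), ← Real.log_mul (by positivity) (Real.exp_pos _).ne']
      exact Real.log_le_log hδ h2
    have h4 : Real.log (2 * M) - Real.log δ ≤ C₀ := by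
      rw [← Real.log_div (by positivity) hδ.ne']
      exact le_max_right _ _
    have h5 : ((d : ℝ) - 1) / 2 - F ≤ C₀ / ξ := by
      rw [le_div_iff₀ hξpos]
      linarith
    linarith
  obtain ⟨π, c, k, hπ⟩ := exists_perm_near y (div_nonneg hC₀0 hξpos.le) hkey
  refine ⟨π, ∑ j, (k j : ℝ) • t j, by rw [hL]; exact sum_zsmul_mem_span t k, ?_⟩
  have h1 : s - ∑ j, (k j : ℝ) • t j - simplexPoint t (permVec π) =
      ∑ j, (y j - k j - c - ((π j : ℕ) : ℝ) / d) • t j := by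
    rw [← hshift c, simplexPoint, Finset.smul_sum, ← Finset.sum_sub_distrib,
      ← Finset.sum_sub_distrib]
    refine Finset.sum_congr rfl fun j _ => ?_
    rw [smul_smul, ← sub_smul, ← sub_smul, permVec]
    congr 1
    push_cast
    ring
  rw [h1]
  -- The error `C₀ / ξ` in the coefficients meets vectors of length `O(ξ)`, so `ξ` cancels and the
  -- bound is uniform.
  calc ‖∑ j, (y j - k j - c - ((π j : ℕ) : ℝ) / d) • t j‖
      ≤ ∑ _j : Fin d, C₀ / ξ * (d * (d * ξ)) := by
        refine norm_sum_le_of_le _ fun j _ => ?_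
        rw [norm_smul]
        exact mul_le_mul (hπ j) (hnorm j) (norm_nonneg _) (div_nonneg hC₀0 hξpos.le)
    _ = d * (d * d) * C₀ := by
        simp
        field_simp
    _ ≤ _ := by linarith

/-! ### Compact sets of shapes -/

lemma finrank_R0 [NeZero d] : Module.finrank ℝ (R0 d) = d - 1 := by
  let f : Module.Dual ℝ (EuclideanSpace ℝ (Fin d)) :=
    ∑ i, (EuclideanSpace.proj i : EuclideanSpace ℝ (Fin d) →L[ℝ] ℝ).toLinearMap
  have hf : ∀ v, f v = ∑ i, v i := fun v => by simp [f]
  have hker : R0 d = LinearMap.ker f := by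
    ext v
    rw [LinearMap.mem_ker, hf]
    rfl
  have hne : f ≠ 0 := by
    intro h
    have h1 := hf (EuclideanSpace.single 0 1)
    rw [h] at h1
    simp at h1
  have h1 := Module.Dual.finrank_ker_add_one_of_ne_zero hne
  rw [finrank_euclideanSpace_fin] at h1
  rw [hker]
  omega

lemma span_eq_top_of_frame [NeZero d] {b : Fin (d - 1) → R0 d} (hb : LinearIndependent ℝ b) :
    Submodule.span ℝ (Set.range b) = ⊤ :=
  hb.span_eq_top_of_card_eq_finrank' (by rw [finrank_R0, Fintype.card_fin])

/-- Quantitative linear independence of a tuple of vectors of bounded length. -/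
def IsBoundedFrame (m : ℕ) (b : Fin (d - 1) → R0 d) : Prop :=
  (∀ i, ‖b i‖ < m) ∧ ∃ a : ℝ, 1 < m * a ∧ ∀ y : Fin (d - 1) → ℝ, a * ‖y‖ ≤ ‖∑ i, y i • b i‖

lemma isOpen_isBoundedFrame (m : ℕ) : IsOpen {b : Fin (d - 1) → R0 d | IsBoundedFrame m b} := by
  rw [isOpen_iff_mem_nhds]
  rintro b ⟨h1, a, ha, h2⟩
  have e1 : ∀ᶠ b' in nhds b, ∀ i, ‖b' i‖ < (m : ℝ) := by
    rw [Filter.eventually_all]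
    intro i
    exact ((continuous_apply i).norm.tendsto b).eventually (gt_mem_nhds (h1 i))
  have hcont : Filter.Tendsto (fun b' : Fin (d - 1) → R0 d => m * (a - ∑ i, ‖b i - b' i‖)) (nhds b)
      (nhds (m * a)) := by
    have : Continuous fun b' : Fin (d - 1) → R0 d => (m : ℝ) * (a - ∑ i, ‖b i - b' i‖) := by
      fun_prop
    convert this.tendsto b
    simp
  -- The constant `a - ∑ ‖b i - b' i‖` works for the perturbed tuple; the strict inequalities in the
  -- definition survive.
  filter_upwards [e1, hcont.eventually (lt_mem_nhds ha)] with b' hb1 hb2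
  refine ⟨hb1, _, hb2, fun y => ?_⟩
  have h3 : ‖∑ i, y i • (b i - b' i)‖ ≤ (∑ i, ‖b i - b' i‖) * ‖y‖ := by
    rw [Finset.sum_mul]
    refine norm_sum_le_of_le _ fun i _ => ?_
    rw [norm_smul, mul_comm]
    exact mul_le_mul_of_nonneg_left (norm_le_pi_norm y i) (norm_nonneg _)
  have h4 : ∑ i, y i • b i = ∑ i, y i • b' i + ∑ i, y i • (b i - b' i) := by
    rw [← Finset.sum_add_distrib]
    exact Finset.sum_congr rfl fun i _ => by rw [← smul_add]; congr 1; abel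
  have h5 := h2 y
  rw [h4] at h5
  have h6 := norm_add_le (∑ i, y i • b' i) (∑ i, y i • (b i - b' i))
  rw [sub_mul]
  linarith

lemma IsBoundedFrame.mono {m k : ℕ} (hmk : m ≤ k) {b : Fin (d - 1) → R0 d}
    (h : IsBoundedFrame m b) : IsBoundedFrame k b := by
  have hc : (m : ℝ) ≤ k := by exact_mod_cast hmk
  obtain ⟨h1, a, ha, h2⟩ := h
  have ha0 : 0 < a := by
    by_contra hn
    nlinarith [Nat.cast_nonneg (α := ℝ) m]
  exact ⟨fun i => (h1 i).trans_le hc, a, ha.trans_le (mul_le_mul_of_nonneg_right hc ha0.le), h2⟩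

/-- An injective linear map on a finite-dimensional space is bounded below. -/
lemma exists_isBoundedFrame {b : Fin (d - 1) → R0 d} (hb : LinearIndependent ℝ b) :
    ∃ m, IsBoundedFrame m b := by
  obtain ⟨C, hC0, hC⟩ := (Fintype.linearCombination ℝ b).exists_antilipschitzWith
    (by rw [LinearMap.ker_eq_bot]; exact linearIndependent_iff_injective_fintypeLinearCombination.1 hb)
  obtain ⟨m, hm⟩ := exists_nat_gt (max (C : ℝ) (∑ i, ‖b i‖))
  have hC0' : (0 : ℝ) < C := hC0
  refine ⟨m, fun i => ?_, (C : ℝ)⁻¹, ?_, fun y => ?_⟩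
  · refine lt_of_le_of_lt ?_ ((le_max_right _ _).trans_lt hm)
    exact Finset.single_le_sum (f := fun i => ‖b i‖) (fun _ _ => norm_nonneg _) (Finset.mem_univ i)
  · rw [← div_eq_mul_inv, one_lt_div hC0']
    exact (le_max_left _ _).trans_lt hm
  · have h1 := hC.le_mul_dist y 0
    rw [dist_zero_right, map_zero, dist_zero_right, Fintype.linearCombination_apply] at h1
    rwa [inv_mul_le_iff₀ hC0']

/-- The shapes of the lattices spanned by `m`-bounded frames. -/
def boundedShapes (d m : ℕ) : Set (Shape d) :=
  {s | ∃ b : Frame d, b.shape = s ∧ IsBoundedFrame m b.1}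

/-- Suppose that `b'` has the same shape as a bounded frame `b`. For `f` near `b'`, the linear map
taking `b'` to `f` carries `b` to a frame `Ψ f` with the shape of `f`. It depends continuously on
`f` and equals `b` at `f = b'`, so openness of boundedness for frames passes to shapes. -/
lemma isOpen_boundedShapes [NeZero d] (m : ℕ) : IsOpen (boundedShapes d m) := by
  have hq : Topology.IsQuotientMap (Frame.shape (d := d)) := isQuotientMap_quot_mk
  rw [← hq.isOpen_preimage, isOpen_iff_mem_nhds]
  rintro b' ⟨b, hbb, hb⟩
  obtain ⟨c, hc, hcb⟩ := Quotient.exact hbb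
  let B := Module.Basis.mk b'.2 (span_eq_top_of_frame b'.2).ge
  have hB : ∀ i, B i = b'.1 i := fun i => by simp [B]
  let T : Frame d → R0 d →ₗ[ℝ] R0 d := fun f => B.constr ℝ f.1
  have hT : ∀ f i, T f (b'.1 i) = f.1 i := fun f i => by rw [← hB, Module.Basis.constr_basis]
  have hTinj : ∀ f, LinearMap.ker (T f) = ⊥ := by
    intro f
    rw [LinearMap.ker_eq_bot']
    intro v hv
    have h1 : T f v = ∑ i, B.repr v i • f.1 i := by
      rw [Module.Basis.constr_apply_fintype]
      simp
    rw [h1] at hv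
    have h2 := Fintype.linearIndependent_iff.1 f.2 _ hv
    apply B.repr.injective
    ext i
    simpa using h2 i
  let Ψ : Frame d → Frame d := fun f => ⟨fun i => T f (b.1 i), b.2.map' _ (hTinj f)⟩
  have hΨcont : Continuous Ψ := by
    refine Continuous.subtype_mk (continuous_pi fun i => ?_) _
    have : (fun f : Frame d => T f (b.1 i)) = fun f => ∑ j, B.repr (b.1 i) j • f.1 j := by
      funext f
      rw [Module.Basis.constr_apply_fintype]
      simp
    rw [this]
    exact continuous_finsetSum _ fun j _ =>
      (continuous_const_smul _).comp ((continuous_apply j).comp continuous_subtype_val)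
  have hmap : ∀ (f : Frame d) (g : Fin (d - 1) → R0 d), Submodule.span ℤ (Set.range fun i => T f (g i)) =
      (Submodule.span ℤ (Set.range g)).map (T f).toAddMonoidHom.toIntLinearMap := by
    intro f g
    rw [Submodule.map_span, ← Set.range_comp]
    rfl
  have hΨshape : ∀ f, (Ψ f).shape = f.shape := by
    intro f
    refine Quotient.sound ⟨c, hc, fun v => ?_⟩
    have h1 : (Ψ f).lattice = b.lattice.map (T f).toAddMonoidHom.toIntLinearMap := hmap f b.1
    have h2 : f.lattice = b'.lattice.map (T f).toAddMonoidHom.toIntLinearMap := by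
      have h3 := hmap f b'.1
      simp only [hT] at h3
      exact h3
    rw [h1, h2]
    constructor
    · rintro ⟨u, hu, rfl⟩
      exact ⟨c • u, (hcb u).1 hu, (T f).map_smul c u⟩
    · rintro ⟨u, hu, huv⟩
      have hu' : c • c⁻¹ • u = u := by rw [smul_smul, mul_inv_cancel₀ hc.ne', one_smul]
      refine ⟨c⁻¹ • u, (hcb _).2 (by rwa [hu']), ?_⟩
      have h4 : T f u = c • v := huv
      change T f (c⁻¹ • u) = v
      rw [LinearMap.map_smul, h4, smul_smul, inv_mul_cancel₀ hc.ne', one_smul]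
  have hΨb : Ψ b' = b := by
    apply Subtype.ext
    funext i
    change T b' (b.1 i) = b.1 i
    have : T b' = LinearMap.id := B.ext fun j => by rw [hB, hT]; rfl
    rw [this]
    rfl
  have hopen : IsOpen {f : Frame d | IsBoundedFrame m (Ψ f).1} :=
    (isOpen_isBoundedFrame m).preimage (continuous_subtype_val.comp hΨcont)
  refine Filter.mem_of_superset (hopen.mem_nhds ?_) fun f hf => ⟨Ψ f, hΨshape f, hf⟩
  rw [Set.mem_ofPred_eq, hΨb]
  exact hb

/-- Lattices whose shapes lie in a compact set have uniformly bounded bases, up to homothety. -/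
lemma exists_bounded_basis [NeZero d] {K : Set (Shape d)} (hK : IsCompact K) :
    ∃ m : ℝ, 0 < m ∧ ∀ L, HasShapeIn K L → ∃ (b : Fin (d - 1) → R0 d) (ρ : ℝ), 0 < ρ ∧
      LinearIndependent ℝ b ∧ L = Submodule.span ℤ (Set.range b) ∧ (∀ i, ‖b i‖ ≤ m * ρ) ∧
      ∀ y : Fin (d - 1) → ℝ, ρ * ‖y‖ ≤ m * ‖∑ i, y i • b i‖ := by
  -- The sets `boundedShapes d m` form an increasing open cover, so a single `m` serves all of `K`.
  obtain ⟨m, hm⟩ := hK.elim_directed_cover (boundedShapes d) isOpen_boundedShapes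
    (by
      intro s _
      induction s using Quotient.inductionOn with
      | h b =>
        obtain ⟨m, hm⟩ := exists_isBoundedFrame b.2
        exact Set.mem_iUnion.2 ⟨m, b, rfl, hm⟩)
    (directed_of_isDirected_le fun m k hmk => by
      rintro s ⟨b, hb, hbm⟩
      exact ⟨b, hb, hbm.mono hmk⟩)
  refine ⟨m + 1, by positivity, ?_⟩
  rintro L ⟨b', rfl, hb'⟩
  obtain ⟨b, hbb, h1, a, ha, h2⟩ := hm hb'
  obtain ⟨ρ, hρ, h⟩ := Quotient.exact hbb
  have ha0 : 0 < a := by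
    by_contra hn
    nlinarith [Nat.cast_nonneg (α := ℝ) m]
  -- The bounded representative `b` is rescaled by the homothety factor to become a basis of the
  -- given lattice.
  refine ⟨fun i => ρ • b.1 i, ρ, hρ, ?_, ?_, fun i => ?_, fun y => ?_⟩
  · exact b.2.units_smul fun _ => Units.mk0 ρ hρ.ne'
  · have h3 : Submodule.span ℤ (Set.range fun i => ρ • b.1 i) =
        b.lattice.map (LinearMap.lsmul ℝ (R0 d) ρ).toAddMonoidHom.toIntLinearMap := by
      rw [Frame.lattice, Submodule.map_span, ← Set.range_comp]
      rfl
    rw [h3]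
    ext v
    constructor
    · intro hv
      have hv' : ρ • ρ⁻¹ • v = v := by rw [smul_smul, mul_inv_cancel₀ hρ.ne', one_smul]
      exact ⟨ρ⁻¹ • v, (h _).2 (by rwa [hv']), hv'⟩
    · rintro ⟨u, hu, rfl⟩
      exact (h u).1 hu
  · rw [norm_smul, Real.norm_of_nonneg hρ.le]
    nlinarith [h1 i]
  · have h3 : ∑ i, y i • ρ • b.1 i = ρ • ∑ i, y i • b.1 i := by
      rw [Finset.smul_sum]
      exact Finset.sum_congr rfl fun i _ => smul_comm _ _ _
    rw [h3, norm_smul, Real.norm_of_nonneg hρ.le]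
    have h4 := h2 y
    have h5 : ‖y‖ ≤ (m + 1) * ‖∑ i, y i • b.1 i‖ := by
      nlinarith [norm_nonneg y, norm_nonneg (∑ i, y i • b.1 i), Nat.cast_nonneg (α := ℝ) m]
    nlinarith

lemma le_norm_of_mem_span_int {b : Fin (d - 1) → R0 d} {m ρ : ℝ} (hρ : 0 < ρ)
    (hb : ∀ y : Fin (d - 1) → ℝ, ρ * ‖y‖ ≤ m * ‖∑ i, y i • b i‖) {v : R0 d}
    (hv : v ∈ Submodule.span ℤ (Set.range b)) (hv0 : v ≠ 0) : ρ ≤ m * ‖v‖ := by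
  obtain ⟨k, rfl⟩ := (Submodule.mem_span_range_iff_exists_fun ℤ).1 hv
  have hk : k ≠ 0 := by
    rintro rfl
    simp at hv0
  obtain ⟨i, hi⟩ := Function.ne_iff.1 hk
  have h1 := hb fun i => (k i : ℝ)
  simp only [Int.cast_smul_eq_zsmul] at h1
  refine le_trans ?_ h1
  have h2 : (1 : ℝ) ≤ ‖fun i => (k i : ℝ)‖ := by
    refine le_trans ?_ (norm_le_pi_norm _ i)
    rw [Real.norm_eq_abs, ← Int.cast_abs]
    exact_mod_cast Int.one_le_abs hi
  nlinarith

/-! ### Covolume against length scale -/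

/-- The fundamental parallelepiped lies in a ball of radius `(d - 1) * |m| * ρ`. -/
lemma covolume_span_le [NeZero d] (m : ℝ) : ∃ C : ℝ, 0 < C ∧ ∀ (b : Fin (d - 1) → R0 d) (ρ : ℝ),
    0 < ρ → LinearIndependent ℝ b → (∀ i, ‖b i‖ ≤ m * ρ) →
      ZLattice.covolume (Submodule.span ℤ (Set.range b)) ≤ C * ρ ^ (d - 1) := by
  set V := (MeasureTheory.volume : MeasureTheory.Measure (R0 d)).real (Metric.closedBall 0 1) with hV
  refine ⟨(((d - 1 : ℕ) : ℝ) * |m|) ^ (d - 1) * V + 1, by positivity, ?_⟩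
  intro b ρ hρ hb hm
  let B := Module.Basis.mk hb (span_eq_top_of_frame hb).ge
  have hB : Set.range B = Set.range b := by rw [Module.Basis.coe_mk]
  have hBi : ∀ i, B i = b i := fun i => by simp [B]
  rw [← hB, ZLattice.covolume_eq_measure_fundamentalDomain _ _
    (ZSpan.isAddFundamentalDomain B MeasureTheory.volume)]
  have hsub : ZSpan.fundamentalDomain B ⊆ Metric.closedBall 0 ((d - 1 : ℕ) * |m| * ρ) := by
    intro v hv
    rw [ZSpan.mem_fundamentalDomain] at hv
    rw [mem_closedBall_zero_iff, ← B.sum_repr v]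
    calc ‖∑ i, B.repr v i • B i‖ ≤ ∑ _i : Fin (d - 1), |m| * ρ := by
          refine norm_sum_le_of_le _ fun i _ => ?_
          rw [norm_smul, hBi, Real.norm_of_nonneg (hv i).1]
          calc B.repr v i * ‖b i‖ ≤ 1 * (m * ρ) :=
                mul_le_mul (hv i).2.le (hm i) (norm_nonneg _) zero_le_one
            _ ≤ |m| * ρ := by rw [one_mul]; exact mul_le_mul_of_nonneg_right (le_abs_self m) hρ.le
      _ = _ := by simp; ring
  refine (MeasureTheory.measureReal_mono hsub (Metric.isBounded_closedBall.measure_lt_top).ne).trans ?_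
  rw [MeasureTheory.measureReal_def, MeasureTheory.Measure.addHaar_closedBall' _ _ (by positivity),
    ENNReal.toReal_mul, ENNReal.toReal_ofReal (by positivity), finrank_R0,
    ← MeasureTheory.measureReal_def, ← hV, mul_pow]
  have : 0 < ρ ^ (d - 1) := by positivity
  nlinarith

/-- A lattice without short vectors has large covolume. -/
lemma le_covolume [NeZero d] : ∃ C : ℝ, 0 < C ∧ ∀ (L : Submodule ℤ (R0 d)) [DiscreteTopology L]
    [IsZLattice ℝ L] (l : ℝ), 0 < l → (∀ v ∈ L, v ≠ 0 → l ≤ ‖v‖) →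
      C * l ^ (d - 1) ≤ ZLattice.covolume L := by
  set V := (MeasureTheory.volume : MeasureTheory.Measure (R0 d)).real (Metric.ball 0 1) with hV
  have hVpos : 0 < V := ENNReal.toReal_pos (Metric.measure_ball_pos _ _ one_pos).ne'
    (Metric.isBounded_ball.measure_lt_top).ne
  refine ⟨(1 / 2) ^ (d - 1) * V, by positivity, ?_⟩
  intro L _ _ l hl h
  let b := Module.Free.chooseBasis ℤ L
  have hfund := ZLattice.isAddFundamentalDomain b (MeasureTheory.volume : MeasureTheory.Measure (R0 d))
  have : Countable L.toAddSubgroup := inferInstanceAs (Countable L)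
  set F := ZSpan.fundamentalDomain (Module.Basis.ofZLatticeBasis ℝ L b)
  have hvol : (MeasureTheory.volume : MeasureTheory.Measure (R0 d)).real (Metric.ball 0 (l * (1 / 2))) =
      (1 / 2) ^ (d - 1) * V * l ^ (d - 1) := by
    rw [MeasureTheory.measureReal_def, MeasureTheory.Measure.addHaar_ball_mul_of_pos _ _ hl,
      ← mul_one (1 / 2 : ℝ), MeasureTheory.Measure.addHaar_ball_mul_of_pos _ _ (by norm_num : (0 : ℝ) < 1 / 2),
      ENNReal.toReal_mul, ENNReal.toReal_mul, ENNReal.toReal_ofReal (by positivity),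
      ENNReal.toReal_ofReal (by positivity), finrank_R0, ← MeasureTheory.measureReal_def, ← hV]
    ring
  rw [← hvol, ZLattice.covolume_eq_measure_fundamentalDomain L _ hfund]
  have hFfin : (MeasureTheory.volume : MeasureTheory.Measure (R0 d)) F ≠ ⊤ :=
    (ZSpan.fundamentalDomain_isBounded _).measure_lt_top.ne
  refine ENNReal.toReal_mono hFfin ?_
  by_contra hlt
  -- Blichfeldt's argument: a ball of radius `l / 2` larger in volume than the fundamental domain
  -- meets a translate of itself, which produces a nonzero lattice vector shorter than `l`.
  obtain ⟨x, y, hxy, hdis⟩ := MeasureTheory.exists_pair_mem_lattice_not_disjoint_vadd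
    (L := L.toAddSubgroup) hfund
    Metric.isOpen_ball.measurableSet.nullMeasurableSet (not_le.1 hlt)
  rw [Set.not_disjoint_iff] at hdis
  obtain ⟨p, ⟨q, hq, hqp⟩, ⟨q', hq', hqp'⟩⟩ := hdis
  have e1 : (x : R0 d) + q = p := hqp
  have e2 : (y : R0 d) + q' = p := hqp'
  rw [mem_ball_zero_iff] at hq hq'
  have h1 := h ((x - y : L) : R0 d) (x - y).2 (by
    rw [Ne, ZeroMemClass.coe_eq_zero, sub_eq_zero]
    exact hxy)
  have h2 : ((x - y : L) : R0 d) = q' - q := by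
    rw [AddSubgroupClass.coe_sub, sub_eq_sub_iff_add_eq_add, e1, add_comm, e2]
  rw [h2] at h1
  have := norm_sub_le q' q
  linarith

/-! ### Finiteness of orbits with bounded stabilizers -/

/-- For `x` the coset of `g`, the matrix `g⁻¹ * expDiag t * g` is integral and conjugate to `expDiag
t`. -/
lemma exists_int_conj {x : LatticeSpace d} {t : R0 d} (h : expDiag t • x = x) :
    ∃ N : Matrix (Fin d) (Fin d) ℤ, (N.map (Int.castRingHom ℝ)).charpoly =
      ∏ i, (Polynomial.X - Polynomial.C (Real.exp (coord t i))) := by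
  induction x using QuotientGroup.induction_on with
  | H g =>
    have h1 : g⁻¹ * (expDiag t * g) ∈ SLZ d := QuotientGroup.eq.1 h.symm
    obtain ⟨N, hN⟩ := exists_int_of_mem_SLZ h1
    refine ⟨N, ?_⟩
    have h2 : N.map (Int.castRingHom ℝ) = (g⁻¹).1 * ((expDiag t).1 * g.1) := by
      rw [← Matrix.SpecialLinearGroup.coe_mul, ← Matrix.SpecialLinearGroup.coe_mul]
      ext i j
      rw [hN]
      rfl
    rw [h2, Matrix.charpoly_mul_comm, Matrix.mul_assoc, ← Matrix.SpecialLinearGroup.coe_mul,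
      mul_inv_cancel, Matrix.SpecialLinearGroup.coe_one, Matrix.mul_one]
    exact Matrix.charpoly_diagonal _

/-- The numbers `exp (2 t_i)` are the roots of a monic integral polynomial of degree `d`, a
characteristic polynomial. A bound on `t` bounds its coefficients, which leaves finitely many
polynomials and hence finitely many roots. -/
lemma finite_bounded_logStab (R : ℝ) :
    {t : R0 d | ‖t‖ ≤ R ∧ ∃ x : LatticeSpace d, t ∈ logStab x}.Finite := by
  classical
  set B : ℝ := max (Real.exp (2 * R)) 1 ^ d * (d.choose (d / 2)) with hB
  set U : Set ℝ := ⋃ (f : Polynomial ℤ) (_ : f.natDegree ≤ d ∧ ∀ i, f.coeff i ∈ Set.Icc (-⌈B⌉) ⌈B⌉),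
    ((f.map (Int.castRingHom ℝ)).roots.toFinset : Set ℝ) with hU
  have hUfin : U.Finite := Polynomial.bUnion_roots_finite _ d (Set.finite_Icc _ _)
  have hinj : Function.Injective fun (t : R0 d) (i : Fin d) => Real.exp (2 * coord t i) := by
    intro s t hst
    ext i
    have := Real.exp_injective (congrFun hst i)
    linarith
  refine Set.Finite.subset ((Set.Finite.pi' fun _ : Fin d => hUfin).preimage hinj.injOn) ?_
  rintro t ⟨htR, x, hx⟩ i
  obtain ⟨N, hN⟩ := exists_int_conj (expDiag_add_self_smul hx)
  have hNp : N.charpoly.map (Int.castRingHom ℝ) =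
      ∏ i, (Polynomial.X - Polynomial.C (Real.exp (2 * coord t i))) := by
    rw [← Matrix.charpoly_map, hN]
    simp only [coord_add, two_mul]
  have hroots : (N.charpoly.map (Int.castRingHom ℝ)).roots =
      Finset.univ.val.map fun i => Real.exp (2 * coord t i) := by
    have h1 := Polynomial.roots_multiset_prod_X_sub_C
      (Finset.univ.val.map fun i => Real.exp (2 * coord t i))
    rw [Multiset.map_map] at h1
    rw [hNp]
    exact h1
  have hdeg : N.charpoly.natDegree ≤ d := by
    rw [Matrix.charpoly_natDegree_eq_dim, Fintype.card_fin]
  refine Set.mem_iUnion₂.2 ⟨N.charpoly, ⟨hdeg, fun k => ?_⟩, ?_⟩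
  · have h1 := Polynomial.coeff_bdd_of_roots_le (B := Real.exp (2 * R)) (d := d) (Int.castRingHom ℝ)
      (Matrix.charpoly_monic N) (by
        rw [hNp]
        exact Polynomial.Splits.prod fun i _ => Polynomial.Splits.X_sub_C _) hdeg (by
        intro z hz
        rw [hroots, Multiset.mem_map] at hz
        obtain ⟨l, -, rfl⟩ := hz
        rw [Real.norm_of_nonneg (Real.exp_pos _).le, Real.exp_le_exp]
        linarith [le_abs_self (coord t l), abs_coord_le_norm t l]) k
    rw [Polynomial.coeff_map, eq_intCast, Real.norm_eq_abs, ← hB, abs_le] at h1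
    have h2 : B ≤ (⌈B⌉ : ℤ) := Int.le_ceil B
    constructor
    · have h3 : ((-⌈B⌉ : ℤ) : ℝ) ≤ N.charpoly.coeff k := by push_cast; linarith [h1.1]
      exact_mod_cast h3
    · have h3 : (N.charpoly.coeff k : ℝ) ≤ (⌈B⌉ : ℤ) := h1.2.trans h2
      exact_mod_cast h3
  · rw [Finset.mem_coe, Multiset.mem_toFinset, hroots]
    exact Multiset.mem_map_of_mem _ (Finset.mem_univ_val i)

lemma coord_stdVec (i j : Fin d) : coord (stdVec j) i = if i = j then 1 - (d : ℝ) else 1 := rfl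

/-- A spanning tuple generates a vector with pairwise distinct coordinates. -/
lemma exists_coord_injective [NeZero d] {b : Fin (d - 1) → R0 d} (hb : LinearIndependent ℝ b) :
    ∃ t ∈ Submodule.span ℤ (Set.range b), Function.Injective (coord t) := by
  -- The vector sought is `∑ N ^ k • b k`; its coordinates `i` and `j` agree exactly when `N` is a
  -- root of `q i j`. Since `b` spans, `q i j` is nonzero for `i ≠ j`, so all but finitely many `N`
  -- work.
  let q : Fin d → Fin d → Polynomial ℝ := fun i j =>
    ∑ k : Fin (d - 1), Polynomial.C (coord (b k) i - coord (b k) j) * Polynomial.X ^ (k : ℕ)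
  have hq : ∀ i j, i ≠ j → q i j ≠ 0 := by
    intro i j hij h0
    have h1 : ∀ k, coordₗ i (b k) = coordₗ j (b k) := by
      intro k
      have h2 := congrArg (fun p => Polynomial.coeff p k) h0
      simp only [q, Polynomial.finsetSum_coeff, Polynomial.coeff_C_mul_X_pow, Polynomial.coeff_zero] at h2
      rw [Finset.sum_eq_single k] at h2
      · rw [if_pos rfl] at h2
        exact sub_eq_zero.1 h2
      · intro l _ hl
        rw [if_neg]
        exact fun h => hl (Fin.ext h.symm)
      · intro hk
        exact absurd (Finset.mem_univ k) hk
    have h2 : coordₗ (d := d) i = coordₗ j :=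
      LinearMap.ext_on_range (span_eq_top_of_frame hb) h1
    have h3 : coord (stdVec i) i = coord (stdVec i) j := LinearMap.congr_fun h2 (stdVec i)
    rw [coord_stdVec, coord_stdVec, if_pos rfl, if_neg hij.symm] at h3
    have : (d : ℝ) ≠ 0 := by exact_mod_cast NeZero.ne d
    apply this
    linarith
  have hev : ∀ᶠ N : ℕ in Filter.cofinite, ∀ i j, i ≠ j → (q i j).eval (N : ℝ) ≠ 0 := by
    rw [Filter.eventually_all]
    intro i
    rw [Filter.eventually_all]
    intro j
    by_cases hij : i = j
    · exact Filter.Eventually.of_forall fun _ h => absurd hij h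
    · have hfin : {N : ℕ | (q i j).eval (N : ℝ) = 0}.Finite := by
        exact (Polynomial.finite_setOfPred_isRoot (hq i j hij)).preimage
          (Nat.cast_injective (R := ℝ)).injOn
      filter_upwards [hfin.compl_mem_cofinite] with N hN _
      exact hN
  obtain ⟨N, hN⟩ := hev.exists
  refine ⟨∑ k : Fin (d - 1), ((N ^ (k : ℕ) : ℕ) : ℤ) • b k, ?_, ?_⟩
  · exact Submodule.sum_mem _ fun k _ => Submodule.smul_mem _ _ (Submodule.subset_span ⟨k, rfl⟩)
  · intro i j hij
    by_contra hne
    apply hN i j hne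
    rw [Polynomial.eval_finsetSum]
    simp only [Polynomial.eval_mul, Polynomial.eval_C, Polynomial.eval_pow, Polynomial.eval_X]
    simp only [← Int.cast_smul_eq_zsmul ℝ, coord_sum, coord_smul] at hij
    push_cast at hij
    rw [← sub_eq_zero, ← Finset.sum_sub_distrib] at hij
    rw [← hij]
    exact Finset.sum_congr rfl fun k _ => by ring

/-- The lattice points of an orbit with a stabilizer of full rank have nonzero coordinates. -/
lemma coord_ne_zero_of_mem_points [NeZero d] {x : LatticeSpace d} {b : Fin (d - 1) → R0 d}
    (hb : LinearIndependent ℝ b) (hbx : ∀ k, b k ∈ logStab x) {v : Fin d → ℝ} (hv : v ∈ points x)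
    (hv0 : v ≠ 0) (i : Fin d) : v i ≠ 0 := by
  intro hi
  obtain ⟨ε₀, hε₀, hle⟩ := exists_pos_le_norm_of_mem_points x
  -- The direction `-stdVec i` contracts every coordinate except the `i`-th. If `v i = 0`, rounding
  -- its large multiples to integer combinations of `b` gives arbitrarily short nonzero points of
  -- `x`.
  have hspan : -stdVec i ∈ Submodule.span ℝ (Set.range b) := by
    rw [span_eq_top_of_frame hb]; trivial
  obtain ⟨y, hy⟩ := (Submodule.mem_span_range_iff_exists_fun ℝ).1 hspan
  set Q := ∑ k, ‖b k‖ with hQ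
  have hlim : Filter.Tendsto (fun N : ℕ => Real.exp (Q - N) * ‖v‖) Filter.atTop (nhds (0 * ‖v‖)) := by
    refine Filter.Tendsto.mul_const _ ?_
    refine Real.tendsto_exp_atBot.comp ?_
    exact Filter.tendsto_atBot_add_const_left _ Q
      (Filter.tendsto_neg_atTop_atBot.comp tendsto_natCast_atTop_atTop)
  rw [zero_mul] at hlim
  obtain ⟨N, hN⟩ := (hlim.eventually (gt_mem_nhds hε₀)).exists
  set u : R0 d := ∑ k, ⌊(N : ℝ) * y k⌋ • b k with hu
  have hux : u ∈ logStab x := Submodule.sum_mem _ fun k _ => Submodule.smul_mem _ _ (hbx k)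
  have hdiff : (N : ℝ) • -stdVec i - u = ∑ k, Int.fract ((N : ℝ) * y k) • b k := by
    rw [← hy, hu, Finset.smul_sum, ← Finset.sum_sub_distrib]
    refine Finset.sum_congr rfl fun k _ => ?_
    rw [← Int.cast_smul_eq_zsmul ℝ, smul_smul, ← sub_smul]
    rfl
  have hnorm : ‖(N : ℝ) • -stdVec i - u‖ ≤ Q := by
    rw [hdiff]
    refine norm_sum_le_of_le _ fun k _ => ?_
    rw [norm_smul, Real.norm_of_nonneg (Int.fract_nonneg _)]
    exact mul_le_of_le_one_left (norm_nonneg _) (Int.fract_lt_one _).le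
  have hcoord : ∀ j, j ≠ i → coord u j ≤ Q - N := by
    intro j hj
    have h1 := (abs_coord_le_norm ((N : ℝ) • -stdVec i - u) j).trans hnorm
    rw [coord_sub, coord_smul, coord_neg, coord_stdVec, if_neg hj, abs_le] at h1
    linarith [h1.1]
  obtain ⟨ε, hε, hpts⟩ := exists_sign_of_mem_logStab hux
  have hmem : (fun l => ε l * Real.exp (coord u l) * v l) ∈ points x := by
    rw [← hpts]
    exact ⟨v, hv, rfl⟩
  have hne : (fun l => ε l * Real.exp (coord u l) * v l) ≠ 0 := by
    obtain ⟨l, hl⟩ := Function.ne_iff.1 hv0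
    refine Function.ne_iff.2 ⟨l, mul_ne_zero (mul_ne_zero ?_ (Real.exp_pos _).ne') hl⟩
    intro h0
    have := hε l
    rw [h0] at this
    simp at this
  refine absurd (hle _ hmem hne) (not_le.2 (lt_of_le_of_lt ?_ hN))
  refine (pi_norm_le_iff_of_nonneg (by positivity)).2 fun l => ?_
  by_cases hl : l = i
  · rw [hl, hi, mul_zero, norm_zero]
    positivity
  · rw [norm_mul, norm_mul, Real.norm_eq_abs (ε l), hε, one_mul,
      Real.norm_of_nonneg (Real.exp_pos _).le]
    exact mul_le_mul (Real.exp_le_exp.2 (hcoord l hl)) (norm_le_pi_norm v l) (norm_nonneg _)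
      (Real.exp_pos _).le

/-- Lattice vectors as columns of a matrix have an integral determinant, which bounds the
denominators of the lattice points in terms of these vectors. -/
lemma exists_int_det {x : LatticeSpace d} {P : Matrix (Fin d) (Fin d) ℝ}
    (hP : ∀ k, P.col k ∈ points x) :
    ∃ D : ℤ, (D : ℝ) = P.det ∧ ∀ p ∈ points x, ∃ k : Fin d → ℤ,
      (D : ℝ) • p = P.mulVec fun i => (k i : ℝ) := by
  induction x using QuotientGroup.induction_on with
  | H g =>
    rw [points_mk] at *
    choose m hm using hP
    let N : Matrix (Fin d) (Fin d) ℤ := Matrix.of fun i j => m j i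
    have hPN : P = g.1 * N.map (Int.castRingHom ℝ) := by
      ext i j
      have := congrFun (hm j) i
      simp only [Matrix.col_apply] at this
      rw [← this]
      simp [N, Matrix.mulVec, dotProduct, Matrix.mul_apply]
    have hdet : ((N.det : ℤ) : ℝ) = (N.map (Int.castRingHom ℝ)).det := by
      rw [← RingHom.mapMatrix_apply, ← RingHom.map_det]
      rfl
    refine ⟨N.det, by rw [hPN, Matrix.det_mul, hdet, g.2, one_mul], ?_⟩
    rintro _ ⟨k, rfl⟩
    -- Cramer's rule: the adjugate clears the denominator `det N`.
    refine ⟨N.adjugate.mulVec k, ?_⟩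
    dsimp only
    have h1 : (fun i => ((N.adjugate.mulVec k i : ℤ) : ℝ)) =
        ((N.map (Int.castRingHom ℝ)).adjugate).mulVec fun i => (k i : ℝ) := by
      rw [← RingHom.mapMatrix_apply, ← RingHom.map_adjugate]
      exact (mulVec_intCast _ _).symm
    rw [h1, hPN, Matrix.mulVec_mulVec, Matrix.mul_assoc, Matrix.mul_adjugate, hdet,
      Matrix.mul_smul, Matrix.mul_one, Matrix.smul_mulVec]

/-- The matrix with the columns `a ^ k v`. -/
def orbitMatrix (a v : Fin d → ℝ) : Matrix (Fin d) (Fin d) ℝ :=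
  Matrix.diagonal v * Matrix.vandermonde a

lemma orbitMatrix_det (a v : Fin d → ℝ) :
    (orbitMatrix a v).det = (∏ i, v i) * (Matrix.vandermonde a).det := by
  rw [orbitMatrix, Matrix.det_mul, Matrix.det_diagonal]

lemma orbitMatrix_mulVec (a v w : Fin d → ℝ) (i : Fin d) :
    (orbitMatrix a v).mulVec w i = v i * (Matrix.vandermonde a).mulVec w i := by
  rw [orbitMatrix, ← Matrix.mulVec_mulVec, Matrix.mulVec_diagonal]

lemma orbitMatrix_mulVec_mem {x : LatticeSpace d} {a v : Fin d → ℝ}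
    (hP : ∀ k, (orbitMatrix a v).col k ∈ points x) (m : Fin d → ℤ) :
    (orbitMatrix a v).mulVec (fun i => (m i : ℝ)) ∈ points x := by
  rw [Matrix.mulVec_eq_sum]
  refine sum_mem_points _ _ fun k _ => ?_
  rw [op_smul_eq_smul]
  exact zsmul_mem_points (hP k) (m k)

/-- A description of the lattice `x` in terms of the lattice spanned by the vectors `a ^ k v`,
by the determinant, the signs of the coordinates of `v` and the remaining lattice points. -/
def IsOrbitKey (a : Fin d → ℝ) (x : LatticeSpace d)
    (key : ℤ × (Fin d → SignType) × Set (Fin d → ℤ)) : Prop :=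
  ∃ v : Fin d → ℝ, (∀ i, v i ≠ 0) ∧ (∀ k, (orbitMatrix a v).col k ∈ points x) ∧
    (key.1 : ℝ) = (orbitMatrix a v).det ∧ (∀ i, SignType.sign (v i) = key.2.1 i) ∧
    key.2.2 = {k | (∀ i, 0 ≤ k i ∧ k i < |key.1|) ∧
      (key.1 : ℝ)⁻¹ • (orbitMatrix a v).mulVec (fun i => (k i : ℝ)) ∈ points x}

/-- The ratios `v' i / v i` are positive by equality of signs and have product one by equality of
determinants, so they define an element of `A`. It carries the sublattice of `v` to that of `v'`,
and the finite set of residues determines the rest of each lattice. -/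
lemma orbitA_eq_of_isOrbitKey {a : Fin d → ℝ} (ha : Function.Injective a) {x x' : LatticeSpace d}
    {key : ℤ × (Fin d → SignType) × Set (Fin d → ℤ)} (h : IsOrbitKey a x key)
    (h' : IsOrbitKey a x' key) : orbitA x = orbitA x' := by
  obtain ⟨D, sg, S⟩ := key
  obtain ⟨v, hv0, hcol, hD, hsg, hS⟩ := h
  obtain ⟨v', hv0', hcol', hD', hsg', hS'⟩ := h'
  dsimp only at *
  have hV : (Matrix.vandermonde a).det ≠ 0 := Matrix.det_vandermonde_ne_zero_iff.2 ha
  rw [orbitMatrix_det] at hD hD'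
  have hprod : ∏ i, v i = ∏ i, v' i := mul_right_cancel₀ hV (hD.symm.trans hD')
  have hprod0 : ∏ i, v' i ≠ 0 := Finset.prod_ne_zero_iff.2 fun i _ => hv0' i
  have hD0R : (D : ℝ) ≠ 0 := by rw [hD']; exact mul_ne_zero hprod0 hV
  have hD0 : D ≠ 0 := by exact_mod_cast hD0R
  have hq : ∀ i, 0 < v' i / v i := by
    intro i
    have h1 : SignType.sign (v i) = SignType.sign (v' i) := (hsg i).trans (hsg' i).symm
    rcases lt_or_gt_of_ne (hv0 i) with hlt | hgt
    · have : v' i < 0 := by rwa [← sign_eq_neg_one_iff, ← h1, sign_eq_neg_one_iff]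
      exact div_pos_of_neg_of_neg this hlt
    · have : 0 < v' i := by rwa [← sign_eq_one_iff, ← h1, sign_eq_one_iff]
      exact div_pos this hgt
  let t : R0 d := ofCoord (fun i => Real.log (v' i / v i)) (by
    rw [← Real.log_prod fun i _ => (hq i).ne', Finset.prod_div_distrib, hprod,
      div_self hprod0, Real.log_one])
  have ht : ∀ p : Fin d → ℝ, (expDiag t).1.mulVec p = fun i => v' i / v i * p i := by
    intro p
    rw [expDiag_mulVec]
    funext i
    rw [coord_ofCoord, Real.exp_log (hq i)]
  have hsub : points (expDiag t • x) ⊆ points x' := by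
    rw [points_smul]
    rintro _ ⟨p, hp, rfl⟩
    obtain ⟨D₂, hD₂, hk⟩ := exists_int_det hcol
    have hDD : D₂ = D := by
      have : (D₂ : ℝ) = D := by rw [hD₂, orbitMatrix_det, hD]
      exact_mod_cast this
    subst hDD
    obtain ⟨k, hk⟩ := hk p hp
    -- Reduction of `k` modulo the determinant: the quotient contributes a vector of the sublattice,
    -- the remainder is recorded in `S`.
    have hsplit : ∀ w : Fin d → ℝ, (D₂ : ℝ)⁻¹ • (orbitMatrix a w).mulVec (fun i => (k i : ℝ)) =
        (D₂ : ℝ)⁻¹ • (orbitMatrix a w).mulVec (fun i => ((k i % D₂ : ℤ) : ℝ)) +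
          (orbitMatrix a w).mulVec (fun i => ((k i / D₂ : ℤ) : ℝ)) := by
      intro w
      have : (fun i => (k i : ℝ)) = (fun i => ((k i % D₂ : ℤ) : ℝ)) +
          (D₂ : ℝ) • fun i => ((k i / D₂ : ℤ) : ℝ) := by
        funext i
        have := congrArg (Int.cast : ℤ → ℝ) (Int.emod_add_mul_ediv (k i) D₂)
        push_cast at this
        simp [this]
      rw [this, Matrix.mulVec_add, Matrix.mulVec_smul, smul_add, smul_smul,
        inv_mul_cancel₀ hD0R, one_smul]
    have hpk : p = (D₂ : ℝ)⁻¹ • (orbitMatrix a v).mulVec (fun i => (k i : ℝ)) := by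
      rw [← hk, smul_smul, inv_mul_cancel₀ hD0R, one_smul]
    have hrS : (fun i => k i % D₂) ∈ S := by
      rw [hS]
      refine ⟨fun i => ⟨Int.emod_nonneg _ hD0, Int.emod_lt_abs _ hD0⟩, ?_⟩
      have h1 := hsplit v
      rw [← hpk, ← sub_eq_iff_eq_add] at h1
      rw [← h1, sub_eq_add_neg]
      refine add_mem_points hp ?_
      have h2 := zsmul_mem_points (orbitMatrix_mulVec_mem hcol fun i => k i / D₂) (-1)
      simpa using h2
    rw [hS'] at hrS
    have h3 : (expDiag t).1.mulVec p = (D₂ : ℝ)⁻¹ • (orbitMatrix a v').mulVec (fun i => (k i : ℝ)) := by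
      rw [ht, hpk]
      funext i
      simp only [Pi.smul_apply, orbitMatrix_mulVec, smul_eq_mul]
      field_simp [hv0 i]
    rw [h3, hsplit]
    exact add_mem_points hrS.2 (orbitMatrix_mulVec_mem hcol' _)
  have heq : expDiag t • x = x' := by
    generalize expDiag t • x = y at hsub
    induction y using QuotientGroup.induction_on with
    | H g =>
      induction x' using QuotientGroup.induction_on with
      | H h => exact mk_eq_mk_of_points_subset hsub
  rw [← heq, orbitA_expDiag_smul]

/-- A period with distinct coordinates gives a diagonal matrix `a` that preserves `x` and has
distinct eigenvalues. Applied to an almost shortest vector `v`, its powers span a sublattice of full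
rank. The determinant is bounded by that of the Vandermonde matrix of `a`, which depends only on
`b`. So only finitely many keys occur. -/
lemma finite_orbits_of_frame [NeZero d] {b : Fin (d - 1) → R0 d} (hb : LinearIndependent ℝ b) (M : ℝ) :
    {O | ∃ x : LatticeSpace d, (∀ k, b k ∈ logStab x) ∧ minLength x ≤ M ∧ orbitA x = O}.Finite := by
  obtain ⟨t, htb, htinj⟩ := exists_coord_injective hb
  set a : Fin d → ℝ := fun i => Real.exp (coord (t + t) i) with ha
  have hainj : Function.Injective a := by
    intro i j hij
    have := Real.exp_injective hij
    rw [coord_add, coord_add] at this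
    exact htinj (by linarith)
  set B : ℤ := ⌈(M + 1) ^ d * |(Matrix.vandermonde a).det|⌉ with hB
  let T : Set (ℤ × (Fin d → SignType) × Set (Fin d → ℤ)) :=
    Set.Icc (-B) B ×ˢ (Set.univ ×ˢ 𝒫 {k | ∀ i, k i ∈ Set.Icc 0 B})
  have hT : T.Finite := (Set.finite_Icc _ _).prod
    (Set.finite_univ.prod (Set.Finite.pi' fun _ => Set.finite_Icc _ _).finite_subsets)
  have hkey : ∀ x : LatticeSpace d, (∀ k, b k ∈ logStab x) → minLength x ≤ M →
      ∃ key ∈ T, IsOrbitKey a x key := by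
    intro x hbx hxM
    obtain ⟨v, hv, hv0, hvM⟩ := exists_norm_lt_of_minLength_lt (show minLength x < M + 1 by linarith)
    have hvi := coord_ne_zero_of_mem_points hb hbx hv hv0
    have htx : t ∈ logStab x := Submodule.span_le.2 (by rintro _ ⟨k, rfl⟩; exact hbx k) htb
    have hmul : ∀ p ∈ points x, (fun i => a i * p i) ∈ points x := by
      intro p hp
      have h1 := points_smul (expDiag (t + t)) x
      rw [expDiag_add_self_smul htx] at h1
      rw [h1]
      exact ⟨p, hp, expDiag_mulVec _ _⟩
    have hpow : ∀ n : ℕ, (fun i => a i ^ n * v i) ∈ points x := by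
      intro n
      induction n with
      | zero => simpa using hv
      | succ n ih =>
        have := hmul _ ih
        simp only [pow_succ', mul_assoc]
        exact this
    have hcol : ∀ k, (orbitMatrix a v).col k ∈ points x := by
      intro k
      have : (orbitMatrix a v).col k = fun i => a i ^ (k : ℕ) * v i := by
        funext i
        simp [orbitMatrix, Matrix.vandermonde_apply, mul_comm]
      rw [this]
      exact hpow k
    obtain ⟨D, hD, -⟩ := exists_int_det hcol
    have hDB : |D| ≤ B := by
      have h1 : (|D| : ℝ) ≤ (M + 1) ^ d * |(Matrix.vandermonde a).det| := by
        rw [hD, orbitMatrix_det, abs_mul, Finset.abs_prod]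
        refine mul_le_mul_of_nonneg_right ?_ (abs_nonneg _)
        calc ∏ i, |v i| ≤ ∏ _i : Fin d, (M + 1) :=
              Finset.prod_le_prod (fun _ _ => abs_nonneg _) fun i _ =>
                (norm_le_pi_norm v i).trans hvM.le
          _ = (M + 1) ^ d := by simp
      have h2 : ((|D| : ℤ) : ℝ) ≤ B := by
        push_cast
        exact h1.trans (Int.le_ceil _)
      exact_mod_cast h2
    refine ⟨(D, fun i => SignType.sign (v i), {k | (∀ i, 0 ≤ k i ∧ k i < |D|) ∧
      (D : ℝ)⁻¹ • (orbitMatrix a v).mulVec (fun i => (k i : ℝ)) ∈ points x}),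
      ⟨abs_le.1 hDB, trivial, ?_⟩, v, hvi, hcol, hD, fun i => rfl, rfl⟩
    rintro k ⟨hk, -⟩ i
    exact ⟨(hk i).1, (hk i).2.le.trans hDB⟩
  have hfin : (⋃ key ∈ T, {O | ∃ x : LatticeSpace d, IsOrbitKey a x key ∧ orbitA x = O}).Finite := by
    refine hT.biUnion fun key _ => Set.Subsingleton.finite ?_
    rintro _ ⟨x, hx, rfl⟩ _ ⟨x', hx', rfl⟩
    exact orbitA_eq_of_isOrbitKey hainj hx hx'
  refine hfin.subset ?_
  rintro _ ⟨x, hbx, hxM, rfl⟩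
  obtain ⟨key, hkT, hk⟩ := hkey x hbx hxM
  exact Set.mem_iUnion₂.2 ⟨key, hkT, x, hk, rfl⟩

/-- There are only finitely many orbits of lattices of bounded minimal length whose logarithmic
stabilizers contain bases of bounded length. -/
lemma finite_orbits_of_bounded_frame [NeZero d] (R M : ℝ) :
    {O | ∃ x : LatticeSpace d, (∃ b : Fin (d - 1) → R0 d, LinearIndependent ℝ b ∧
      ∀ k, ‖b k‖ ≤ R ∧ b k ∈ logStab x) ∧ minLength x ≤ M ∧ orbitA x = O}.Finite := by
  have h1 : {b : Fin (d - 1) → R0 d | ∀ k, b k ∈ {t : R0 d | ‖t‖ ≤ R ∧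
      ∃ x : LatticeSpace d, t ∈ logStab x}}.Finite := Set.Finite.pi' fun _ => finite_bounded_logStab R
  refine ((h1.inter_of_left {b | LinearIndependent ℝ b}).biUnion fun b hb =>
    finite_orbits_of_frame hb.2 M).subset ?_
  rintro O ⟨x, ⟨b, hb, hbx⟩, hxM, rfl⟩
  exact Set.mem_iUnion₂.2 ⟨b, ⟨fun k => ⟨(hbx k).1, x, (hbx k).2⟩, hb⟩, x, fun k => (hbx k).2, hxM, rfl⟩

/-! ### Combinatorics of the points of a simplex set -/

/-- All entries of the integer vector are congruent modulo `d`. -/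
def IsConstMod (m : Fin d → ℤ) : Prop := ∀ i j, (d : ℤ) ∣ m i - m j

/-- By rank and nullity the relations among the `t j` form a line, and `hsum` puts the constant
vectors on it. -/
lemma const_of_sum_smul_eq_zero [NeZero d] {t : Fin d → R0 d}
    (hspan : Submodule.span ℝ (Set.range t) = ⊤) (hsum : ∑ j, t j = 0) {y : Fin d → ℝ}
    (hy : ∑ j, y j • t j = 0) (i j : Fin d) : y i = y j := by
  let T := Fintype.linearCombination ℝ t
  have hrange : LinearMap.range T = ⊤ := by rw [Fintype.range_linearCombination, hspan]
  have h1 := LinearMap.finrank_range_add_finrank_ker T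
  rw [hrange, finrank_top, finrank_R0, Module.finrank_fin_fun] at h1
  have h2 : Module.finrank ℝ (LinearMap.ker T) = 1 := by
    have := NeZero.pos d
    omega
  have hone : (fun _ => 1 : Fin d → ℝ) ∈ LinearMap.ker T := by
    rw [LinearMap.mem_ker, Fintype.linearCombination_apply]
    simpa using hsum
  have hyk : y ∈ LinearMap.ker T := by
    rw [LinearMap.mem_ker, Fintype.linearCombination_apply, hy]
  obtain ⟨c, hc⟩ := (finrank_eq_one_iff_of_nonzero' (⟨_, hone⟩ : LinearMap.ker T) (by
    intro h0
    have := congrFun (congrArg Subtype.val h0) i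
    simp at this)).1 h2 ⟨y, hyk⟩
  have hc' := congrArg Subtype.val hc
  have e1 := congrFun hc' i
  have e2 := congrFun hc' j
  simp only [SetLike.val_smul, Pi.smul_apply, smul_eq_mul, mul_one] at e1 e2
  rw [← e1, ← e2]

lemma smul_simplexPoint [NeZero d] (t : Fin d → R0 d) (m : Fin d → ℤ) :
    (d : ℝ) • simplexPoint t m = ∑ j, (m j : ℝ) • t j := by
  rw [simplexPoint, smul_smul, mul_inv_cancel₀ (by exact_mod_cast NeZero.ne d), one_smul]

/-- Coefficients are unique up to a common real constant, so membership means that the entries of `m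
/ d` differ by integers. -/
lemma simplexPoint_mem_span_iff [NeZero d] {t : Fin d → R0 d}
    (hspan : Submodule.span ℝ (Set.range t) = ⊤) (hsum : ∑ j, t j = 0) (m : Fin d → ℤ) :
    simplexPoint t m ∈ Submodule.span ℤ (Set.range t) ↔ IsConstMod m := by
  have hd : (d : ℝ) ≠ 0 := by exact_mod_cast NeZero.ne d
  constructor
  · intro h i j
    obtain ⟨k, hk⟩ := (Submodule.mem_span_range_iff_exists_fun ℤ).1 h
    have h1 : ∑ j, ((m j : ℝ) - d * k j) • t j = 0 := by
      simp only [sub_smul, Finset.sum_sub_distrib, mul_smul, ← Finset.smul_sum,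
        Int.cast_smul_eq_zsmul]
      rw [hk, smul_simplexPoint]
      simp only [Int.cast_smul_eq_zsmul, sub_self]
    have h2 := const_of_sum_smul_eq_zero hspan hsum h1 i j
    refine ⟨k i - k j, ?_⟩
    have h3 : (m i : ℝ) - m j = d * (k i - k j) := by linarith
    exact_mod_cast h3
  · intro h
    choose k hk using fun j => h j 0
    have h1 : simplexPoint t m = ∑ j, (k j : ℝ) • t j := by
      have h2 : ∑ j, ((m j : ℝ) - m 0) • t j = ∑ j, (m j : ℝ) • t j := by
        simp only [sub_smul, Finset.sum_sub_distrib, ← Finset.smul_sum, hsum, smul_zero, sub_zero]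
      rw [simplexPoint, ← h2, Finset.smul_sum]
      refine Finset.sum_congr rfl fun j _ => ?_
      have h3 : (m j : ℝ) - m 0 = d * k j := by exact_mod_cast hk j
      rw [h3, smul_smul, ← mul_assoc, inv_mul_cancel₀ hd, one_mul]
    rw [h1]
    exact sum_zsmul_mem_span t k

lemma eq_of_dvd_permVec_sub {π : Equiv.Perm (Fin d)} {i j : Fin d}
    (h : (d : ℤ) ∣ permVec π i - permVec π j) : i = j := by
  have h1 : permVec π i - permVec π j = 0 := by
    refine Int.eq_zero_of_abs_lt_dvd h ?_
    have := (π i).2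
    have := (π j).2
    simp only [permVec]
    rw [abs_lt]
    constructor <;> omega
  apply π.injective
  apply Fin.ext
  simp only [permVec] at h1
  omega

lemma dvd_finRotate_sub [NeZero d] (x : Fin d) : (d : ℤ) ∣ ((finRotate d x : ℕ) : ℤ) - (x : ℕ) - 1 := by
  obtain ⟨n, rfl⟩ := Nat.exists_eq_succ_of_ne_zero (NeZero.ne d)
  rw [coe_finRotate]
  split_ifs with h
  · rw [h]
    exact ⟨-1, by simp; ring⟩
  · simp

lemma dvd_finRotate_zpow_sub [NeZero d] (k : ℤ) (x : Fin d) :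
    (d : ℤ) ∣ (((finRotate d ^ k) x : ℕ) : ℤ) - (x : ℕ) - k := by
  induction k generalizing x with
  | zero => simp
  | succ k ih =>
    rw [add_comm, zpow_add, zpow_one, Equiv.Perm.mul_apply]
    have h1 := dvd_finRotate_sub ((finRotate d ^ (k : ℤ)) x)
    refine (dvd_add h1 (ih x)).trans (dvd_of_eq ?_)
    ring
  | pred k ih =>
    have h1 := dvd_finRotate_sub ((finRotate d ^ (-(k : ℤ) - 1)) x)
    have h2 : finRotate d ((finRotate d ^ (-(k : ℤ) - 1)) x) = (finRotate d ^ (-(k : ℤ))) x := by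
      rw [← Equiv.Perm.mul_apply, ← zpow_one_add]
      congr 2
      ring
    rw [h2] at h1
    refine (dvd_sub (ih x) h1).trans (dvd_of_eq ?_)
    ring

/-- Composing with the `k`-th power of the cycle adds `k` modulo `d` to every entry. Together with
`simplexPoint_mem_span_iff`, cosets of the cycle group become classes of points modulo `Δ_Φ`. -/
lemma mem_zpowers_iff_isConstMod [NeZero d] (σ τ : Equiv.Perm (Fin d)) :
    σ⁻¹ * τ ∈ Subgroup.zpowers (finRotate d) ↔ IsConstMod (permVec σ⁻¹ - permVec τ⁻¹) := by
  constructor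
  · rintro ⟨k, hk⟩ i j
    have h1 : ∀ i, (d : ℤ) ∣ (permVec σ⁻¹ - permVec τ⁻¹) i - k := by
      intro i
      have h2 : σ⁻¹ i = (finRotate d ^ k) (τ⁻¹ i) := by
        have hk' : finRotate d ^ k = σ⁻¹ * τ := hk
        rw [hk', ← Equiv.Perm.mul_apply, mul_assoc, mul_inv_cancel, mul_one]
      have h3 := dvd_finRotate_zpow_sub k (τ⁻¹ i)
      rw [← h2] at h3
      exact h3
    refine (dvd_sub (h1 i) (h1 j)).trans (dvd_of_eq ?_)
    ring
  · intro h
    set k : ℤ := (permVec σ⁻¹ - permVec τ⁻¹) 0 with hk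
    refine ⟨k, ?_⟩
    change finRotate d ^ k = σ⁻¹ * τ
    ext x
    have h1 := dvd_finRotate_zpow_sub k x
    have h2 := h (τ x) 0
    rw [← hk] at h2
    have h5 : τ⁻¹ (τ x) = x := τ.symm_apply_apply x
    simp only [Pi.sub_apply, permVec, h5] at h2
    have h3 : (d : ℤ) ∣ (((finRotate d ^ k) x : ℕ) : ℤ) - ((σ⁻¹ (τ x) : ℕ) : ℤ) := by
      refine (dvd_sub h1 h2).trans (dvd_of_eq ?_)
      ring
    have h4 := Int.eq_zero_of_abs_lt_dvd h3 (by
      have := ((finRotate d ^ k) x).2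
      have := (σ⁻¹ (τ x)).2
      rw [abs_lt]
      constructor <;> omega)
    rw [Equiv.Perm.mul_apply]
    omega

/-- Representatives inject into the cosets of a cyclic group of order `d` in a group of order `d!`.
-/
lemma ncard_le_of_isCosetReps (hd : 2 ≤ d) {S : Set (Equiv.Perm (Fin d))} (hS : IsCosetReps S) :
    S.ncard ≤ (d - 1).factorial := by
  classical
  have hord : orderOf (finRotate d) = d := by
    rw [(isCycle_finRotate_of_le hd).orderOf, support_finRotate_of_le hd, Finset.card_univ,
      Fintype.card_fin]
  have h1 := (Subgroup.zpowers (finRotate d)).card_mul_index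
  rw [Nat.card_zpowers, hord, Nat.card_eq_fintype_card, Fintype.card_perm, Fintype.card_fin] at h1
  have h2 : (Subgroup.zpowers (finRotate d)).index = (d - 1).factorial := by
    have h3 : d * (d - 1).factorial = d.factorial := Nat.mul_factorial_pred (by omega)
    exact Nat.eq_of_mul_eq_mul_left (by omega) (h1.trans h3.symm)
  rw [← h2, ← Nat.card_coe_set_eq, Subgroup.index]
  refine Nat.card_le_card_of_injective
    (fun σ : S => (σ.1 : Equiv.Perm (Fin d) ⧸ Subgroup.zpowers (finRotate d))) ?_
  intro σ σ' h
  have h3 : σ.1⁻¹ * σ'.1 ∈ Subgroup.zpowers (finRotate d) := QuotientGroup.eq.1 h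
  obtain ⟨ρ, -, hρ⟩ := hS σ'.1
  apply Subtype.ext
  rw [hρ σ.1 ⟨σ.2, h3⟩, hρ σ'.1 ⟨σ'.2, by rw [inv_mul_cancel]; exact one_mem _⟩]

lemma exists_perm_apply_eq {i j k l : Fin d} (hij : i ≠ j) (hkl : k ≠ l) :
    ∃ π : Equiv.Perm (Fin d), π i = k ∧ π j = l := by
  have h1 : Equiv.swap i k j ≠ k := by
    intro h
    have h2 := congrArg (Equiv.swap i k) h
    rw [Equiv.swap_apply_self, Equiv.swap_apply_right] at h2
    exact hij h2.symm
  refine ⟨Equiv.swap (Equiv.swap i k j) l * Equiv.swap i k, ?_, ?_⟩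
  · rw [Equiv.Perm.mul_apply, Equiv.swap_apply_left, Equiv.swap_apply_of_ne_of_ne h1.symm hkl]
  · rw [Equiv.Perm.mul_apply, Equiv.swap_apply_left]

/-! ### Distortion maps -/

lemma sum_stdVec : ∑ j : Fin d, stdVec j = 0 := by
  ext i
  rw [coord_sum, coord_zero]
  simp only [coord_stdVec]
  have h : ∀ j : Fin d, (if i = j then 1 - (d : ℝ) else 1) = 1 - if i = j then (d : ℝ) else 0 := by
    intro j
    split_ifs <;> simp
  simp [h, Finset.sum_sub_distrib]

/-- The matrix of `τ` sends `stdVec l` to `stdVec (τ l)`, so the coefficient at `j` is the one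
formerly at `τ⁻¹ j`. -/
lemma wStd_eq (τ : Equiv.Perm (Fin d)) : wStd τ = simplexPoint stdVec (permVec τ⁻¹) := by
  ext i
  rw [wStd, simplexPoint]
  rw [permAct, coord_ofCoord, coord_smul, coord_smul, coord_sum, coord_sum]
  congr 1
  conv_rhs => rw [← Equiv.sum_comp τ]
  refine Finset.sum_congr rfl fun l _ => ?_
  rw [coord_smul, coord_smul, coord_stdVec, coord_stdVec]
  congr 1
  · simp [permVec]
  · simp only [Equiv.symm_apply_eq]

/-- The map `h` numbers the elements of `Φ`; the two powers of the covolume cancel. -/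
lemma exists_simplex_of_isDistortionMap {Φ : Finset (R0 d)} {h : R0 d ≃ₗ[ℝ] R0 d}
    (hcov : 0 < ZLattice.covolume (latticeOf Φ)) (hh : IsDistortionMap Φ h) :
    ∃ t : Fin d → R0 d, Set.range t = Φ ∧ ∑ j, t j = 0 ∧
      ∀ τ, wPoint Φ h τ = simplexPoint t (permVec τ⁻¹) := by
  set V := ZLattice.covolume (latticeOf Φ) ^ (1 / ((d - 1 : ℕ) : ℝ)) with hV
  have hV0 : 0 < V := Real.rpow_pos_of_pos hcov _
  rw [IsDistortionMap, Real.rpow_neg hcov.le, ← hV] at hh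
  refine ⟨fun j => V • h (stdVec j), ?_, ?_, fun τ => ?_⟩
  · have h1 : Set.range (fun j => V • h (stdVec j)) = V • (h '' Set.range (stdVec (d := d))) := by
      rw [← Set.range_comp, ← Set.image_smul, ← Set.range_comp]
      rfl
    rw [h1, hh, smul_smul, mul_inv_cancel₀ hV0.ne', one_smul]
  · rw [← Finset.smul_sum, ← map_sum, sum_stdVec, map_zero, smul_zero]
  · rw [wPoint, ← hV, wStd_eq, simplexPoint, simplexPoint, map_smul, map_sum, smul_comm,
      Finset.smul_sum]
    congr 1
    refine Finset.sum_congr rfl fun j _ => ?_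
    rw [map_smul, smul_comm]

/-! ### Closed pieces of an orbit -/

lemma isClosed_SLZ : IsClosed (SLZ d : Set (Matrix.SpecialLinearGroup (Fin d) ℝ)) := by
  have h : (SLZ d : Set (Matrix.SpecialLinearGroup (Fin d) ℝ)) =
      ⋂ i, ⋂ j, (fun g : Matrix.SpecialLinearGroup (Fin d) ℝ => g.1 i j) ⁻¹'
        Set.range (Int.cast : ℤ → ℝ) := by
    ext g
    simp only [Set.mem_iInter, Set.mem_preimage, Set.mem_range, SetLike.mem_coe]
    constructor
    · intro hg i j
      obtain ⟨N, hN⟩ := exists_int_of_mem_SLZ hg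
      exact ⟨N i j, (hN i j).symm⟩
    · intro hg
      choose N hN using hg
      exact mem_SLZ_of_int (Matrix.of N) fun i j => (hN i j).symm
  rw [h]
  refine isClosed_iInter fun i => isClosed_iInter fun j => ?_
  exact Int.isClosedEmbedding_coe_real.isClosed_range.preimage
    (continuous_subtype_val.matrix_elem i j)

/-- Points of the quotient are closed because `SLZ d` is, and a compact set of group elements moves
a closed set to a closed set. -/
lemma isClosed_image_smul {K : Set (R0 d)} (hK : IsCompact K) (x : LatticeSpace d) :
    IsClosed ((fun s => expDiag s • x) '' K) := by
  have hx : IsClosed ({x} : Set (LatticeSpace d)) := by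
    induction x using QuotientGroup.induction_on with
    | H g =>
      rw [← (QuotientGroup.isQuotientMap_mk (SLZ d)).isClosed_preimage]
      have : (QuotientGroup.mk : _ → LatticeSpace d) ⁻¹' {(g : LatticeSpace d)} =
          (fun h => g⁻¹ * h) ⁻¹' (SLZ d) := by
        ext h
        rw [Set.mem_preimage, Set.mem_singleton_iff, eq_comm]
        exact QuotientGroup.eq
      rw [this]
      exact isClosed_SLZ.preimage (continuous_const_mul _)
  have h1 := hx.smul_left_of_isCompact (hK.image continuous_expDiag)
  have h2 : (fun s => expDiag s • x) '' K = (expDiag '' K) • ({x} : Set (LatticeSpace d)) := by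
    rw [Set.smul_singleton, ← Set.image_comp]
    rfl
  rwa [h2]

/-! ### Stabilizers without short vectors -/

/-- The visits to the thick part occur near the points of the simplex set, and the logarithmic
stabilizer of `x` has no short vectors. -/
structure IsSeparated (δ : ℝ) (x : LatticeSpace d) (Φ : Finset (R0 d)) (t : Fin d → R0 d)
    (r C : ℝ) : Prop where
  range_eq : Set.range t = Φ
  span_eq_top : Submodule.span ℝ (Set.range t) = ⊤
  sum_eq_zero : ∑ j, t j = 0
  le_logStab : latticeOf Φ ≤ logStab x
  exists_visit : ∃ s : R0 d, expDiag s • x ∈ thick d δ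
  near : ∀ s : R0 d, expDiag s • x ∈ thick d δ →
    ∃ (π : Equiv.Perm (Fin d)), ∃ u ∈ latticeOf Φ, ‖s - u - simplexPoint t (permVec π)‖ ≤ C
  pos : 0 < C
  le : C ≤ r
  sep : ∀ u ∈ logStab x, ‖u‖ ≤ d * (2 * (d * r)) → u = 0

section
variable {δ : ℝ} {x : LatticeSpace d} {Φ : Finset (R0 d)} {t : Fin d → R0 d} {r C : ℝ}
  {h : R0 d ≃ₗ[ℝ] R0 d} {S : Set (Equiv.Perm (Fin d))}

lemma W1_finite : (W1 Φ h S).Finite := (Set.toFinite S).image _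

lemma W2_finite : (W2 Φ h S x r δ).Finite := W1_finite.subset fun _ hw => hw.1

lemma IsSeparated.latticeOf_eq (H : IsSeparated δ x Φ t r C) :
    latticeOf Φ = Submodule.span ℤ (Set.range t) := by rw [latticeOf, H.range_eq]

variable [NeZero d]

lemma IsSeparated.simplexPoint_mem_iff (H : IsSeparated δ x Φ t r C) (m : Fin d → ℤ) :
    simplexPoint t m ∈ latticeOf Φ ↔ IsConstMod m := by
  rw [H.latticeOf_eq, simplexPoint_mem_span_iff H.span_eq_top H.sum_eq_zero]

lemma IsSeparated.le_mul (H : IsSeparated δ x Φ t r C) : C ≤ d * r := by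
  have h1 : (1 : ℝ) ≤ d := by exact_mod_cast NeZero.one_le
  have := H.pos
  have := H.le
  nlinarith

/-- Multiplying by `d` brings the difference into `Δ_x`, where it is too short to be nonzero. -/
lemma IsSeparated.eq_simplexPoint (H : IsSeparated δ x Φ t r C) {u : R0 d} (hu : u ∈ logStab x)
    {m : Fin d → ℤ} (h : ‖u - simplexPoint t m‖ ≤ 2 * (d * r)) : u = simplexPoint t m := by
  have hd : (0 : ℝ) < d := by exact_mod_cast NeZero.pos d
  have h1 : (d : ℝ) • (u - simplexPoint t m) ∈ logStab x := by
    rw [smul_sub, smul_simplexPoint]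
    refine sub_mem ?_ (H.le_logStab ?_)
    · have := (logStab x).smul_mem (d : ℤ) hu
      rwa [← Int.cast_smul_eq_zsmul ℝ, Int.cast_natCast] at this
    · rw [H.latticeOf_eq]
      exact sum_zsmul_mem_span t m
  have h2 := H.sep _ h1 (by
    rw [norm_smul, Real.norm_of_nonneg hd.le]
    exact mul_le_mul_of_nonneg_left h hd.le)
  exact sub_eq_zero.1 ((smul_eq_zero.1 h2).resolve_left hd.ne')

/-- A period of the orbit moves a visit near one point of the simplex set to another one. -/
lemma IsSeparated.exists_perm (H : IsSeparated δ x Φ t r C) {s l : R0 d}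
    (hs : expDiag s • x ∈ thick d δ) (hl : l ∈ latticeOf Φ) {π : Equiv.Perm (Fin d)}
    (hsπ : ‖s - l - simplexPoint t (permVec π)‖ ≤ d * r) {u : R0 d} (hu : u ∈ logStab x) :
    ∃ π' : Equiv.Perm (Fin d), u - simplexPoint t (permVec π' - permVec π) ∈ latticeOf Φ := by
  obtain ⟨π', l', hl', h⟩ := H.near (s + u) ((smul_add_mem_thick_iff hu s δ).2 hs)
  refine ⟨π', ?_⟩
  have h1 : u - (l' - l) = simplexPoint t (permVec π' - permVec π) := by
    refine H.eq_simplexPoint (sub_mem hu (H.le_logStab (sub_mem hl' hl))) ?_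
    have h2 : u - (l' - l) - simplexPoint t (permVec π' - permVec π) =
        (s + u - l' - simplexPoint t (permVec π')) - (s - l - simplexPoint t (permVec π)) := by
      rw [simplexPoint_sub]
      abel
    rw [h2]
    have h3 := norm_sub_le (s + u - l' - simplexPoint t (permVec π'))
      (s - l - simplexPoint t (permVec π))
    linarith [H.le_mul]
  rw [← h1, sub_sub_cancel]
  exact sub_mem hl' hl

/-- Let `u` be congruent to `d⁻¹ ∑ m_j t_j` modulo `Δ_Φ`. Every multiple `k • u` is a period, so `π
+ k m` is, modulo `d` and up to a constant, again a permutation vector. If two entries of `m` were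
incongruent, primality would provide a `k` that makes the corresponding entries of `π + k m`
collide. -/
lemma IsSeparated.logStab_le_of_prime (H : IsSeparated δ x Φ t r C) (hp : d.Prime) :
    logStab x ≤ latticeOf Φ := by
  intro u hu
  obtain ⟨s, hs⟩ := H.exists_visit
  obtain ⟨π, l, hl, h⟩ := H.near s hs
  have hk : ∀ k : ℕ, ∃ π' : Equiv.Perm (Fin d),
      (k : ℤ) • u - simplexPoint t (permVec π' - permVec π) ∈ latticeOf Φ := fun k =>
    H.exists_perm hs hl (h.trans H.le_mul) ((logStab x).smul_mem (k : ℤ) hu)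
  obtain ⟨π₁, h₁⟩ := hk 1
  rw [Nat.cast_one, one_smul] at h₁
  set m := permVec π₁ - permVec π with hm
  have hm_const : IsConstMod m := by
    intro i j
    by_contra hnd
    have hij : i ≠ j := by
      rintro rfl
      simp at hnd
    have : Fact d.Prime := ⟨hp⟩
    set A : ZMod d := ((m i - m j : ℤ) : ZMod d) with hA
    set B : ZMod d := ((permVec π i - permVec π j : ℤ) : ZMod d) with hB
    have hA0 : A ≠ 0 := fun h0 => hnd ((ZMod.intCast_zmod_eq_zero_iff_dvd _ d).1 h0)
    -- This `k` solves `k (m i - m j) + (π i - π j) = 0` modulo `d`.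
    obtain ⟨π', h'⟩ := hk (-B * A⁻¹).val
    set k := (-B * A⁻¹).val with hkdef
    have hconst : IsConstMod (fun i => (k : ℤ) * m i - (permVec π' - permVec π) i) := by
      rw [← H.simplexPoint_mem_iff]
      have h2 := sub_mem h' ((latticeOf Φ).smul_mem (k : ℤ) h₁)
      have h3 : simplexPoint t (fun i => (k : ℤ) * m i - (permVec π' - permVec π) i) =
          (k : ℤ) • simplexPoint t m - simplexPoint t (permVec π' - permVec π) := by
        have : (fun i => (k : ℤ) * m i - (permVec π' - permVec π) i) =
            (fun i => (k : ℤ) * m i) - (permVec π' - permVec π) := rfl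
        rw [this, simplexPoint_sub]
        congr 1
        simp only [simplexPoint, ← Int.cast_smul_eq_zsmul ℝ]
        rw [smul_comm ((k : ℤ) : ℝ) (d : ℝ)⁻¹]
        refine congrArg _ ?_
        rw [Finset.smul_sum]
        refine Finset.sum_congr rfl fun j _ => ?_
        rw [smul_smul]
        push_cast
        rfl
      rw [h3]
      convert h2 using 1
      rw [smul_sub]
      abel
    have h4 := hconst i j
    simp only [Pi.sub_apply] at h4
    rw [← ZMod.intCast_zmod_eq_zero_iff_dvd] at h4
    have h5 : ((permVec π' i - permVec π' j : ℤ) : ZMod d) = 0 := by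
      have hkA : (k : ZMod d) * A + B = 0 := by
        rw [hkdef, ZMod.natCast_zmod_val, mul_assoc, inv_mul_cancel₀ hA0]
        ring
      rw [hA, hB] at hkA
      push_cast at h4 hkA ⊢
      linear_combination hkA - h4
    exact hij (eq_of_dvd_permVec_sub ((ZMod.intCast_zmod_eq_zero_iff_dvd _ d).1 h5))
  have := add_mem h₁ ((H.simplexPoint_mem_iff m).2 hm_const)
  rwa [sub_add_cancel] at this

/-- Here one period suffices: `π + m` must be a permutation vector up to a constant for every `π`,
and a suitable `π` produces a collision unless `m` is constant modulo `d`. -/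
lemma IsSeparated.logStab_le_of_forall_visit (H : IsSeparated δ x Φ t r C)
    (hall : ∀ π : Equiv.Perm (Fin d), ∃ s : R0 d, expDiag s • x ∈ thick d δ ∧
      ∃ l ∈ latticeOf Φ, ‖s - l - simplexPoint t (permVec π)‖ ≤ d * r) :
    logStab x ≤ latticeOf Φ := by
  intro u hu
  have hex : ∀ π : Equiv.Perm (Fin d), ∃ π' : Equiv.Perm (Fin d),
      u - simplexPoint t (permVec π' - permVec π) ∈ latticeOf Φ := by
    intro π
    obtain ⟨s, hs, l, hl, h⟩ := hall π
    exact H.exists_perm hs hl h hu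
  obtain ⟨π₁, h₁⟩ := hex 1
  set m := permVec π₁ - permVec 1 with hm
  have hm_const : IsConstMod m := by
    intro i j
    by_contra hnd
    have hij : i ≠ j := by
      rintro rfl
      simp at hnd
    have hd0 : (d : ℤ) ≠ 0 := by exact_mod_cast NeZero.ne d
    have hD0 := Int.emod_nonneg (m i - m j) hd0
    have hDd := Int.emod_lt_of_pos (m i - m j) (show (0 : ℤ) < d by exact_mod_cast NeZero.pos d)
    set D := ((m i - m j) % d) with hD
    let D' : Fin d := ⟨D.toNat, by omega⟩
    have hD' : ((D' : ℕ) : ℤ) = D := Int.toNat_of_nonneg hD0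
    have hne : (0 : Fin d) ≠ D' := by
      intro h0
      apply hnd
      apply Int.dvd_of_emod_eq_zero
      rw [← hD, ← hD', ← h0]
      simp
    -- With `π i = 0` and `π j = D`, where `D` is the residue of `m i - m j`, the entries `i` and
    -- `j` of `π + m` become congruent.
    obtain ⟨π, hπi, hπj⟩ := exists_perm_apply_eq hij hne
    obtain ⟨π', h'⟩ := hex π
    have hconst : IsConstMod (m - (permVec π' - permVec π)) := by
      rw [← H.simplexPoint_mem_iff, simplexPoint_sub]
      convert sub_mem h' h₁ using 1
      abel
    have h4 := hconst i j
    have h5 : permVec π i = 0 := by simp [permVec, hπi]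
    have h6 : permVec π j = D := by rw [permVec, hπj, hD']
    simp only [Pi.sub_apply, h5, h6] at h4
    have h7 : (d : ℤ) ∣ (m i - m j) - D := Int.dvd_self_sub_emod
    have h8 : (d : ℤ) ∣ permVec π' i - permVec π' j := by
      refine (dvd_sub h7 h4).trans (dvd_of_eq ?_)
      simp only [hm, Pi.sub_apply]
      ring
    exact hij (eq_of_dvd_permVec_sub h8)
  have := add_mem h₁ ((H.simplexPoint_mem_iff m).2 hm_const)
  rwa [sub_add_cancel] at this

lemma IsSeparated.exists_rep (H : IsSeparated δ x Φ t r C)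
    (hw : ∀ τ, wPoint Φ h τ = simplexPoint t (permVec τ⁻¹)) (hS : IsCosetReps S)
    (π : Equiv.Perm (Fin d)) :
    ∃ w ∈ W1 Φ h S, w - simplexPoint t (permVec π) ∈ latticeOf Φ := by
  obtain ⟨σ, ⟨hσS, hσ⟩, -⟩ := hS π⁻¹
  refine ⟨wPoint Φ h σ, ⟨σ, hσS, rfl⟩, ?_⟩
  rw [hw, ← simplexPoint_sub, H.simplexPoint_mem_iff]
  rw [mem_zpowers_iff_isConstMod, inv_inv] at hσ
  exact hσ

/-- The approximation error is at most `C ≤ r`, so the visit itself, moved back by an element of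
`Δ_Φ`, shows that the nearby point of `W'` belongs to `W''`. -/
lemma IsSeparated.exists_mem_W2 (H : IsSeparated δ x Φ t r C)
    (hw : ∀ τ, wPoint Φ h τ = simplexPoint t (permVec τ⁻¹)) (hS : IsCosetReps S) {s : R0 d}
    (hs : expDiag s • x ∈ thick d δ) :
    ∃ w ∈ W2 Φ h S x r δ, ∃ l ∈ latticeOf Φ, ‖s - l - w‖ ≤ C := by
  obtain ⟨π, l, hl, hC⟩ := H.near s hs
  obtain ⟨w, hwW, hwl⟩ := H.exists_rep hw hS π
  set l' := l - (w - simplexPoint t (permVec π)) with hl'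
  have hl'L : l' ∈ latticeOf Φ := sub_mem hl hwl
  have h1 : s - l' - w = s - l - simplexPoint t (permVec π) := by rw [hl']; abel
  refine ⟨w, ⟨hwW, s - l' - w, ?_, ?_⟩, l', hl'L, by rwa [h1]⟩
  · rw [h1]
    exact (supNorm_le_norm _).trans (hC.trans H.le)
  · have h2 : w + (s - l' - w) = s + -l' := by abel
    rw [h2, smul_add_mem_thick_iff (H.le_logStab (neg_mem hl'L))]
    exact hs

lemma IsSeparated.sub_mem_of_near (H : IsSeparated δ x Φ t r C) {u l : R0 d} (hu : u ∈ logStab x)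
    (hl : l ∈ latticeOf Φ) (h : ‖u - l‖ ≤ 2 * (d * r)) : u ∈ latticeOf Φ := by
  have h0 : simplexPoint t (0 : Fin d → ℤ) = 0 := by simp [simplexPoint]
  have h1 := H.eq_simplexPoint (sub_mem hu (H.le_logStab hl)) (m := 0) (by rwa [h0, sub_zero])
  rw [h0, sub_eq_zero] at h1
  rwa [h1]

/-- Translate a fixed visit by the elements of `Δ_x` and record the point of `W''` near which each
translate falls. Equal points mean that the difference of the translations is near `Δ_Φ`, hence in
it by separation. -/
lemma IsSeparated.latticeIndex_le (H : IsSeparated δ x Φ t r C)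
    (hw : ∀ τ, wPoint Φ h τ = simplexPoint t (permVec τ⁻¹)) (hS : IsCosetReps S) :
    latticeIndex x Φ ≠ 0 ∧ latticeIndex x Φ ≤ (W2 Φ h S x r δ).ncard := by
  obtain ⟨s, hs⟩ := H.exists_visit
  have hex : ∀ u : (logStab x).toAddSubgroup, ∃ w : W2 Φ h S x r δ, ∃ l ∈ latticeOf Φ,
      ‖s + u - l - w‖ ≤ C := by
    intro u
    obtain ⟨w, hwW, l, hl, hC⟩ := H.exists_mem_W2 hw hS ((smul_add_mem_thick_iff u.2 s δ).2 hs)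
    exact ⟨⟨w, hwW⟩, l, hl, hC⟩
  choose f l hl hf using hex
  have hinj : ∀ u u', f u = f u' → (-(u : R0 d) + u') ∈ latticeOf Φ := by
    intro u u' huu
    refine H.sub_mem_of_near (l := l u' - l u) (add_mem (neg_mem u.2) u'.2) (sub_mem (hl u') (hl u)) ?_
    have h1 : -(u : R0 d) + u' - (l u' - l u) = (s + u' - l u' - f u') - (s + u - l u - f u) := by
      rw [huu]
      abel
    rw [h1]
    have h2 := norm_sub_le (s + u' - l u' - f u') (s + u - l u - f u)
    linarith [hf u, hf u', H.le_mul]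
  have hfin : Finite (W2 Φ h S x r δ) := W2_finite
  let g : ((logStab x).toAddSubgroup ⧸ (latticeOf Φ).toAddSubgroup.addSubgroupOf (logStab x).toAddSubgroup) →
      W2 Φ h S x r δ := fun q => f q.out
  have hg : Function.Injective g := by
    intro q q' hq
    rw [← q.out_eq', ← q'.out_eq']
    exact QuotientAddGroup.eq.2 (hinj _ _ hq)
  have hfinq := Finite.of_injective g hg
  refine ⟨AddSubgroup.index_ne_zero_of_finite, ?_⟩
  rw [← Nat.card_coe_set_eq]
  exact Nat.card_le_card_of_injective g hg

/-- Visits near inequivalent points lie in different connected components. -/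
lemma IsSeparated.ncard_le_components (H : IsSeparated δ x Φ t r C)
    (hw : ∀ τ, wPoint Φ h τ = simplexPoint t (permVec τ⁻¹)) (hS : IsCosetReps S)
    (hle : logStab x ≤ latticeOf Φ) :
    ((W2 Φ h S x r δ).ncard : ℕ∞) ≤
      ENat.card (ConnectedComponents ↥(orbitA x ∩ thick d δ)) := by
  classical
  let Z : R0 d → Set (LatticeSpace d) := fun w =>
    {y | ∃ l ∈ latticeOf Φ, ∃ b : R0 d, ‖b‖ ≤ d * r ∧ expDiag (w + l + b) • x = y}
  have hZclosed : ∀ w, IsClosed (Z w) := by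
    intro w
    -- Elements of `2 Δ_Φ` fix `x`, so only the parities of the lattice coefficients matter; `ε` is
    -- the set of odd ones. This leaves finitely many images of compact balls.
    have hZ : Z w = ⋃ ε ∈ (Finset.univ : Finset (Finset (Fin d))),
        (fun s => expDiag s • x) '' Metric.closedBall (w + ∑ j ∈ ε, t j) (d * r) := by
      ext y
      simp only [Set.mem_iUnion, Finset.mem_univ, exists_prop, true_and]
      constructor
      · rintro ⟨l, hl, b, hb, rfl⟩
        rw [H.latticeOf_eq] at hl
        obtain ⟨k, rfl⟩ := (Submodule.mem_span_range_iff_exists_fun ℤ).1 hl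
        refine ⟨Finset.univ.filter fun j => k j % 2 = 1,
          w + ∑ j ∈ Finset.univ.filter (fun j => k j % 2 = 1), t j + b, ?_, ?_⟩
        · rw [mem_closedBall_iff_norm, add_sub_cancel_left]
          exact hb
        · set v := ∑ j, (k j / 2) • t j with hv
          have hvx : v ∈ logStab x := H.le_logStab (by
            rw [H.latticeOf_eq]
            exact Submodule.sum_mem _ fun j _ =>
              Submodule.smul_mem _ _ (Submodule.subset_span ⟨j, rfl⟩))
          have hsplit : ∑ j, k j • t j =
              ∑ j ∈ Finset.univ.filter (fun j => k j % 2 = 1), t j + (v + v) := by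
            rw [hv, Finset.sum_filter, ← Finset.sum_add_distrib, ← Finset.sum_add_distrib]
            refine Finset.sum_congr rfl fun j _ => ?_
            rcases Int.emod_two_eq_zero_or_one (k j) with h0 | h1
            · rw [if_neg (by omega), zero_add, ← add_smul]
              congr 1
              omega
            · rw [if_pos h1, ← add_smul]
              nth_rewrite 2 [← one_smul ℤ (t j)]
              rw [← add_smul]
              congr 1
              omega
          rw [hsplit]
          have hre : w + (∑ j ∈ Finset.univ.filter (fun j => k j % 2 = 1), t j + (v + v)) + b =
              (w + ∑ j ∈ Finset.univ.filter (fun j => k j % 2 = 1), t j + b) + (v + v) := by abel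
          rw [hre, expDiag_add _ (v + v), mul_smul, expDiag_add_self_smul hvx]
      · rintro ⟨ε, s, hs, rfl⟩
        rw [mem_closedBall_iff_norm] at hs
        refine ⟨∑ j ∈ ε, t j, ?_, s - (w + ∑ j ∈ ε, t j), hs, ?_⟩
        · rw [H.latticeOf_eq]
          exact Submodule.sum_mem _ fun j _ => Submodule.subset_span ⟨j, rfl⟩
        · rw [add_sub_cancel]
    rw [hZ]
    exact isClosed_biUnion_finset fun ε _ => isClosed_image_smul (isCompact_closedBall _ _) x
  -- A common point makes the two times differ by a period. Separation makes this difference exact,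
  -- and `hle` puts it in `Δ_Φ`, so both points come from the same coset representative.
  have hdisj : ∀ w ∈ W2 Φ h S x r δ, ∀ w' ∈ W2 Φ h S x r δ, ∀ y, y ∈ Z w → y ∈ Z w' → w = w' := by
    rintro _ ⟨⟨σ, hσ, rfl⟩, -⟩ _ ⟨⟨σ', hσ', rfl⟩, -⟩ y ⟨l, hl, b, hb, rfl⟩ ⟨l', hl', b', hb', hy⟩
    have h1 := sub_mem_logStab_of_smul_eq hy
    have h2 : wPoint Φ h σ' + l' + b' - (wPoint Φ h σ + l + b) - (l' - l) -
        simplexPoint t (permVec σ'⁻¹ - permVec σ⁻¹) = b' - b := by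
      rw [simplexPoint_sub, ← hw, ← hw]
      abel
    have h3 := H.eq_simplexPoint (sub_mem h1 (H.le_logStab (sub_mem hl' hl))) (by
      rw [h2]
      linarith [norm_sub_le b' b])
    have h4 : simplexPoint t (permVec σ'⁻¹ - permVec σ⁻¹) ∈ latticeOf Φ := by
      rw [← h3]
      exact sub_mem (hle h1) (sub_mem hl' hl)
    rw [H.simplexPoint_mem_iff, ← mem_zpowers_iff_isConstMod] at h4
    obtain ⟨ρ, -, hρ⟩ := hS σ
    rw [hρ σ' ⟨hσ', h4⟩, hρ σ ⟨hσ, by rw [inv_mul_cancel]; exact one_mem _⟩]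
  let Y : R0 d → Set ↥(orbitA x ∩ thick d δ) := fun w => Subtype.val ⁻¹' Z w
  have hYclopen : ∀ w ∈ W2 Φ h S x r δ, IsClopen (Y w) := by
    intro w hwW
    refine ⟨(hZclosed w).preimage continuous_subtype_val, ?_⟩
    -- Every visit lies in some piece, so the complement of one closed piece is the finite union of
    -- the others.
    have hcompl : (Y w)ᶜ = ⋃ w' ∈ (W2 Φ h S x r δ) \ {w}, Y w' := by
      ext y
      simp only [Set.mem_compl_iff, Set.mem_iUnion, exists_prop, Set.mem_sdiff, Set.mem_singleton_iff]
      constructor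
      · intro hy
        obtain ⟨s, hs⟩ := (orbitA_eq_range x).subset y.2.1
        have hsv : expDiag s • x ∈ thick d δ := by
          have : expDiag s • x = y.1 := hs
          rw [this]
          exact y.2.2
        obtain ⟨w', hw'W, l, hl, hC⟩ := H.exists_mem_W2 hw hS hsv
        have hyw' : y ∈ Y w' := by
          refine ⟨l, hl, s - l - w', hC.trans H.le_mul, ?_⟩
          rw [← hs]
          congr 2
          abel
        exact ⟨w', ⟨hw'W, fun h0 => hy (h0 ▸ hyw')⟩, hyw'⟩
      · rintro ⟨w', ⟨hw'W, hne⟩, hy'⟩ hy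
        exact hne (hdisj w' hw'W w hwW _ hy' hy)
    rw [← isClosed_compl_iff, hcompl]
    exact (W2_finite.subset Set.sdiff_subset).isClosed_biUnion fun w' _ =>
      (hZclosed w').preimage continuous_subtype_val
  have hpt : ∀ w : W2 Φ h S x r δ, ∃ y : ↥(orbitA x ∩ thick d δ), y ∈ Y w := by
    rintro ⟨w, hw1, b, hb, hbt⟩
    refine ⟨⟨expDiag (w + b) • x, ⟨_, expDiag_mem_diagA _, rfl⟩, hbt⟩, 0, zero_mem _, b, ?_, ?_⟩
    · exact (norm_le_supNorm b).trans (mul_le_mul_of_nonneg_left hb (Nat.cast_nonneg d))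
    · rw [add_zero]
  choose y hy using hpt
  rw [W2_finite.cast_ncard_eq, ← ENat.card_coe_set_eq]
  refine ENat.card_le_card_of_injective (f := fun w => ConnectedComponents.mk (y w)) ?_
  intro w w' hww
  have h1 : y w ∈ connectedComponent (y w') := ConnectedComponents.coe_eq_coe'.1 hww
  have h2 := (hYclopen w' w'.2).connectedComponent_subset (hy w') h1
  exact Subtype.ext (hdisj w w.2 w' w'.2 _ (hy w) h2)

end

/-! ### Lattices without short vectors -/

lemma discreteTopology_of_le_norm {L : Submodule ℤ (R0 d)} {l : ℝ} (hl : 0 < l)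
    (h : ∀ v ∈ L, v ≠ 0 → l ≤ ‖v‖) : DiscreteTopology L := by
  apply discreteTopology_of_isOpen_singleton_zero
  have : ({0} : Set L) = Metric.ball 0 l := by
    ext v
    rw [Set.mem_singleton_iff, mem_ball_zero_iff]
    constructor
    · rintro rfl
      simpa using hl
    · intro hv
      by_contra hne
      exact not_le.2 hv (h v v.2 fun h0 => hne (Subtype.ext h0))
  rw [this]
  exact Metric.isOpen_ball

lemma IsSimplexSet.isZLattice_of_le {Φ : Finset (R0 d)} (hΦ : IsSimplexSet Φ)
    {L : Submodule ℤ (R0 d)} (hL : latticeOf Φ ≤ L) [DiscreteTopology L] : IsZLattice ℝ L := by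
  refine ⟨top_unique ?_⟩
  rw [← hΦ.span_eq_top]
  exact Submodule.span_mono fun v hv => hL (Submodule.subset_span hv)

/-- The ratio of the covolumes is the index, a positive integer. -/
lemma covolume_le_of_le {L₁ L₂ : Submodule ℤ (R0 d)} [DiscreteTopology L₁] [IsZLattice ℝ L₁]
    [DiscreteTopology L₂] [IsZLattice ℝ L₂] (h : L₁ ≤ L₂) :
    ZLattice.covolume L₂ ≤ ZLattice.covolume L₁ := by
  have h1 := ZLattice.covolume_div_covolume_eq_relIndex' L₁ L₂ h
  have h2 := ZLattice.covolume_pos L₁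
  have h3 := ZLattice.covolume_pos L₂
  have h4 : (1 : ℝ) ≤ L₁.toAddSubgroup.relIndex L₂.toAddSubgroup := by
    have h5 : (0 : ℝ) < L₁.toAddSubgroup.relIndex L₂.toAddSubgroup := h1 ▸ div_pos h2 h3
    exact_mod_cast h5
  rwa [← h1, one_le_div h3] at h4

lemma IsSimplexSet.exists_enum {Φ : Finset (R0 d)} (hΦ : IsSimplexSet Φ) :
    ∃ t : Fin d → R0 d, Set.range t = Φ ∧ ∑ j, t j = 0 := by
  let e := (Φ.equivFinOfCardEq hΦ.card_eq).symm
  refine ⟨fun j => e j, ?_, ?_⟩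
  · ext v
    constructor
    · rintro ⟨j, rfl⟩
      exact (e j).2
    · intro hv
      exact ⟨e.symm ⟨v, hv⟩, by simp⟩
  · rw [Equiv.sum_comp e fun v : Φ => (v : R0 d), Finset.sum_coe_sort Φ fun v => v]
    exact hΦ.sum_eq_zero

lemma IsTight.minLength_le_self [NeZero d] {M : ℝ} (hM : 0 ≤ M) {x : LatticeSpace d}
    {Φ : Finset (R0 d)} (hΦ : IsTight M x Φ) : minLength x ≤ M := by
  obtain ⟨t, ht⟩ : Φ.Nonempty := by
    rw [← Finset.card_pos, hΦ.isSimplexSet.card_eq]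
    exact NeZero.pos d
  have h1 := (abs_nonneg _).trans (abs_coord_le_of_forall_le (coord_le_xi ht) 0)
  have h2 : 0 ≤ xi Φ := by
    have : (0 : ℝ) < d := by exact_mod_cast NeZero.pos d
    by_contra hneg
    nlinarith
  refine hΦ.minLength_le.trans (mul_le_of_le_one_right hM ?_)
  rw [Real.exp_le_one_iff, neg_mul, neg_nonpos]
  positivity

/-- If the visits to the thick part stay near the well-separated points of one simplex set, then
the logarithmic stabilizer has no short vectors: a short period could not leave the neighbourhood
of a point of the simplex set. -/
lemma le_norm_of_mem_logStab [NeZero d] {δ C l : ℝ} {x : LatticeSpace d} {Φ : Finset (R0 d)}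
    {t : Fin d → R0 d} (ht : Set.range t = Φ)
    (hvisit : ∃ s : R0 d, expDiag s • x ∈ thick d δ)
    (hnear : ∀ s : R0 d, expDiag s • x ∈ thick d δ →
      ∃ (π : Equiv.Perm (Fin d)), ∃ u ∈ latticeOf Φ, ‖s - u - simplexPoint t (permVec π)‖ ≤ C)
    (hl : ∀ v ∈ latticeOf Φ, v ≠ 0 → l ≤ ‖v‖) {u : R0 d} (hu : u ∈ logStab x) (hu0 : u ≠ 0) :
    l ≤ d * (2 * C + ‖u‖) := by
  by_contra! hlt
  have hd : (0 : ℝ) < d := by exact_mod_cast NeZero.pos d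
  obtain ⟨s, hs⟩ := hvisit
  have hk : ∀ k : ℕ, ∃ q : R0 d, (d : ℝ) • q ∈ latticeOf Φ ∧ ‖s + (k : ℝ) • u - q‖ ≤ C := by
    intro k
    have hku : (k : ℝ) • u ∈ logStab x := by
      have := (logStab x).smul_mem (k : ℤ) hu
      rwa [← Int.cast_smul_eq_zsmul ℝ, Int.cast_natCast] at this
    obtain ⟨π, v, hv, h⟩ := hnear _ ((smul_add_mem_thick_iff hku s δ).2 hs)
    refine ⟨v + simplexPoint t (permVec π), ?_, by rwa [← sub_sub]⟩
    rw [smul_add, smul_simplexPoint]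
    refine add_mem ?_ ?_
    · have := (latticeOf Φ).smul_mem (d : ℤ) hv
      rwa [← Int.cast_smul_eq_zsmul ℝ, Int.cast_natCast] at this
    · rw [latticeOf, ← ht]
      exact sum_zsmul_mem_span t _
  choose q hqL hq using hk
  -- Consecutive centres differ by an element of `d⁻¹ Δ_Φ` shorter than `l / d`, so they coincide;
  -- all multiples of `u` are then bounded.
  have hstep : ∀ k, q (k + 1) = q k := by
    intro k
    by_contra hne
    have h1 := hl _ (sub_mem (hqL (k + 1)) (hqL k)) (by
      rw [← smul_sub]
      exact smul_ne_zero hd.ne' (sub_ne_zero.2 hne))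
    rw [← smul_sub, norm_smul, Real.norm_of_nonneg hd.le] at h1
    have h2 : q (k + 1) - q k = (s + (k : ℝ) • u - q k) -
        (s + ((k + 1 : ℕ) : ℝ) • u - q (k + 1)) + u := by
      push_cast
      rw [add_smul, one_smul]
      abel
    have h3 : ‖q (k + 1) - q k‖ ≤ 2 * C + ‖u‖ := by
      rw [h2]
      refine (norm_add_le _ _).trans ?_
      have := norm_sub_le (s + (k : ℝ) • u - q k) (s + ((k + 1 : ℕ) : ℝ) • u - q (k + 1))
      linarith [hq k, hq (k + 1)]
    exact absurd (h1.trans (mul_le_mul_of_nonneg_left h3 hd.le)) (not_le.2 hlt)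
  have hconst : ∀ k, q k = q 0 := fun k => by
    induction k with
    | zero => rfl
    | succ k ih => rw [hstep, ih]
  have hupos : 0 < ‖u‖ := norm_pos_iff.2 hu0
  obtain ⟨k, hk⟩ := exists_nat_gt (2 * C / ‖u‖)
  rw [div_lt_iff₀ hupos] at hk
  have h1 : (k : ℝ) • u = (s + (k : ℝ) • u - q k) - (s + ((0 : ℕ) : ℝ) • u - q 0) := by
    rw [hconst k, Nat.cast_zero, zero_smul]
    abel
  have h2 : ‖(k : ℝ) • u‖ ≤ 2 * C := by
    rw [h1]
    have := norm_sub_le (s + (k : ℝ) • u - q k) (s + ((0 : ℕ) : ℝ) • u - q 0)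
    linarith [hq k, hq 0]
  rw [norm_smul, Real.norm_of_nonneg (Nat.cast_nonneg k)] at h2
  linarith

/-! ### Comparison of the scales -/

lemma mul_pow_rpow_div {n : ℕ} (hn : n ≠ 0) {a ρ κ : ℝ} (ha : 0 ≤ a) (hρ : 0 ≤ ρ) :
    (a * ρ ^ n) ^ (κ / n) = a ^ (κ / n) * ρ ^ κ := by
  rw [Real.mul_rpow ha (by positivity), ← Real.rpow_natCast, ← Real.rpow_mul hρ,
    mul_div_cancel₀ _ (by exact_mod_cast hn : (n : ℝ) ≠ 0)]

/-- When `V` is comparable to `ρ ^ n`, the radius `c V ^ (κ / n)` is comparable to `ρ ^ κ`; as `0 <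
κ < 1`, it tends to infinity with `ρ` but more slowly than `ρ`. -/
lemma exists_scale {n : ℕ} (hn : n ≠ 0) {C c κ a A α β D : ℝ} (hc : 0 < c) (hκ : 0 < κ)
    (hκ' : κ < 1) (ha : 0 < a) (hA : 0 < A) (hα : 0 < α) (hβ : 0 < β) :
    ∃ ρ₀, ∀ ρ ≥ ρ₀, D < ρ ∧ ∀ V : ℝ, a * (α * ρ) ^ n ≤ V → V ≤ A * ρ ^ n →
      C ≤ c * V ^ (κ / n) ∧ β * (c * V ^ (κ / n)) < α * ρ := by
  have e1 := Filter.eventually_gt_atTop (max D 0)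
  have e2 : ∀ᶠ ρ : ℝ in Filter.atTop, C ≤ c * (a * α ^ n) ^ (κ / n) * ρ ^ κ :=
    ((tendsto_rpow_atTop hκ).const_mul_atTop (by positivity)).eventually_ge_atTop C
  have e3 : ∀ᶠ ρ : ℝ in Filter.atTop, β * (c * A ^ (κ / n)) * ρ ^ (-(1 - κ)) < α := by
    have h := (tendsto_rpow_neg_atTop (show 0 < 1 - κ by linarith)).const_mul (β * (c * A ^ (κ / n)))
    rw [mul_zero] at h
    exact h.eventually (gt_mem_nhds hα)
  obtain ⟨ρ₀, h⟩ := Filter.eventually_atTop.1 (e1.and (e2.and e3))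
  refine ⟨ρ₀, fun ρ hρ => ?_⟩
  obtain ⟨h1, h2, h3⟩ := h ρ hρ
  have hρ0 : 0 < ρ := (le_max_right _ _).trans_lt h1
  refine ⟨(le_max_left _ _).trans_lt h1, fun V hV hV' => ?_⟩
  have hexp : 0 ≤ κ / n := by positivity
  have hV0 : 0 ≤ V := le_trans (by positivity) hV
  constructor
  · refine h2.trans ?_
    rw [mul_assoc, ← mul_pow_rpow_div hn (by positivity) hρ0.le]
    refine mul_le_mul_of_nonneg_left (Real.rpow_le_rpow (by positivity) ?_ hexp) hc.le
    rwa [mul_assoc, ← mul_pow]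
  · have h4 : V ^ (κ / n) ≤ A ^ (κ / n) * ρ ^ κ := by
      rw [← mul_pow_rpow_div hn hA.le hρ0.le]
      exact Real.rpow_le_rpow hV0 hV' hexp
    calc β * (c * V ^ (κ / n)) ≤ β * (c * (A ^ (κ / n) * ρ ^ κ)) := by gcongr
      _ = β * (c * A ^ (κ / n)) * ρ ^ (-(1 - κ)) * ρ := by
        have : ρ ^ κ = ρ ^ (-(1 - κ)) * ρ := by
          rw [← Real.rpow_add_one hρ0.ne']
          congr 1
          ring
        rw [this]
        ring
      _ < α * ρ := mul_lt_mul_of_pos_right h3 hρ0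

/-- Outside of finitely many orbits the logarithmic stabilizer has no short vectors, and every
tight simplex set locates the visits to the thick part. -/
lemma exists_finite_forall_isSeparated (hd : 2 ≤ d) {M : ℝ} (hM : 1 < M) {K : Set (Shape d)}
    (hK : IsCompact K) {δ : ℝ} (hδ : 0 < δ) (hδ' : δ < deltaZero d) {κ : ℝ} (hκ : 0 < κ)
    (hκ' : κ < 1) {c : ℝ} (hc : 0 < c) :
    ∃ C : ℝ, ∃ E : Set (Set (LatticeSpace d)), E.Finite ∧ ∀ x ∈ OmegaMK M K, orbitA x ∉ E →
      ∀ Φ : Finset (R0 d), IsTight M x Φ → 0 < ZLattice.covolume (latticeOf Φ) ∧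
        ∀ t : Fin d → R0 d, Set.range t = Φ → ∑ j, t j = 0 →
          IsSeparated δ x Φ t (radius c κ x) C := by
  have hd0 : NeZero d := ⟨by omega⟩
  have hdR : (0 : ℝ) < d := by exact_mod_cast NeZero.pos d
  obtain ⟨C, hC, hnear⟩ := exists_perm_near_visit (d := d) (zero_lt_one.trans hM) hδ
  obtain ⟨m, hm, hbasis⟩ := exists_bounded_basis hK
  obtain ⟨A, hA, hcovle⟩ := covolume_span_le (d := d) m
  obtain ⟨a, ha, hlecov⟩ := le_covolume (d := d)
  -- `D` makes the error `C` negligible, so that `ρ / m ≤ d * (2 * C + ‖v‖)` yields `‖v‖ ≥ α * ρ`;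
  -- `β` is the factor of the radius in the field `sep` of `IsSeparated`.
  obtain ⟨ρ₀, hscale⟩ := exists_scale (n := d - 1) (by omega) (C := C) (c := c) (κ := κ) (a := a) (A := A)
    (α := 1 / (2 * d * m)) (β := d * (2 * d)) (D := 4 * d * m * C) hc hκ hκ' ha hA (by positivity)
    (by positivity)
  refine ⟨C, _, finite_orbits_of_bounded_frame (d := d) (m * ρ₀) M, ?_⟩
  -- Only `Φ'` has a shape in `K`; it controls `Δ_x`, while the given `Φ` is an arbitrary tight set.
  rintro x ⟨-, Φ', hΦ', hshape⟩ hxE Φ hΦ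
  obtain ⟨b, ρ, hρ, hb, hL', hbm, hbl⟩ := hbasis _ hshape
  -- A smaller `ρ` would give periods of length at most `m * ρ₀` that form a basis, and hence an
  -- exceptional orbit.
  have hρ₀ : ρ₀ ≤ ρ := by
    by_contra! hlt
    refine hxE ⟨x, ⟨b, hb, fun k => ⟨(hbm k).trans ?_, ?_⟩⟩,
      hΦ'.minLength_le_self (zero_le_one.trans hM.le), rfl⟩
    · exact mul_le_mul_of_nonneg_left hlt.le hm.le
    · apply zspan_le_logStab hΦ'
      rw [hL']
      exact Submodule.subset_span ⟨k, rfl⟩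
  obtain ⟨hρC, hV⟩ := hscale ρ hρ₀
  set l : ℝ := 1 / (2 * d * m) * ρ with hl
  have hlpos : 0 < l := by positivity
  have hsep' : ∀ v ∈ latticeOf Φ', v ≠ 0 → ρ / m ≤ ‖v‖ := by
    intro v hv hv0
    rw [hL'] at hv
    rw [div_le_iff₀ hm, mul_comm]
    exact le_norm_of_mem_span_int hρ hbl hv hv0
  have hvisit := exists_visit hδ hδ' x
  obtain ⟨t', ht', hsum'⟩ := hΦ'.isSimplexSet.exists_enum
  have hsep : ∀ v ∈ logStab x, v ≠ 0 → l ≤ ‖v‖ := by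
    intro v hv hv0
    have h1 := le_norm_of_mem_logStab ht' hvisit (hnear x Φ' hΦ' t' ht' hsum') hsep' hv hv0
    rw [div_le_iff₀ hm] at h1
    rw [hl, div_mul_eq_mul_div, one_mul, div_le_iff₀ (by positivity)]
    nlinarith
  have hdisc : DiscreteTopology (logStab x) := discreteTopology_of_le_norm hlpos hsep
  have hlat : IsZLattice ℝ (logStab x) := hΦ.isSimplexSet.isZLattice_of_le (zspan_le_logStab hΦ)
  have hdisc' : DiscreteTopology (latticeOf Φ') := discreteTopology_of_le_norm hlpos fun v hv =>
    hsep v (zspan_le_logStab hΦ' hv)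
  have hlat' : IsZLattice ℝ (latticeOf Φ') := hΦ'.isSimplexSet.isZLattice_of_le le_rfl
  have hdiscΦ : DiscreteTopology (latticeOf Φ) := discreteTopology_of_le_norm hlpos fun v hv =>
    hsep v (zspan_le_logStab hΦ hv)
  have hlatΦ : IsZLattice ℝ (latticeOf Φ) := hΦ.isSimplexSet.isZLattice_of_le le_rfl
  have hcov : ZLattice.covolume (logStab x) ≤ A * ρ ^ (d - 1) := by
    refine (covolume_le_of_le (zspan_le_logStab hΦ')).trans ?_
    rw [hL']
    exact hcovle b ρ hρ hb hbm
  obtain ⟨hCr, hrl⟩ := hV (ZLattice.covolume (logStab x)) (hlecov (logStab x) l hlpos hsep) hcov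
  refine ⟨ZLattice.covolume_pos (latticeOf Φ), fun t ht hsum => ⟨ht, ?_, hsum, zspan_le_logStab hΦ, hvisit,
    hnear x Φ hΦ t ht hsum, hC, hCr, fun u hu hur => ?_⟩⟩
  · rw [ht]
    exact hΦ.isSimplexSet.span_eq_top
  · by_contra hu0
    have h1 := (hsep u hu hu0).trans hur
    have h2 : (d : ℝ) * (2 * (d * radius c κ x)) = d * (2 * d) * radius c κ x := by ring
    rw [h2] at h1
    exact absurd h1 (not_le.2 hrl)

end CompactOrbits

end

/-! ### The theorem -/

open CompactOrbits
theorem mainTheorem3 (d : ℕ) (hd : 2 ≤ d) (M : ℝ) (hM : 1 < M)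
    (K : Set (Shape d)) (hK : IsCompact K)
    (δ₁ : ℝ) (hδ₁ : 0 < δ₁) (hδ₁' : δ₁ < deltaZero d)
    (κ : ℝ) (hκ : 0 < κ) (hκ' : κ < 1) (c : ℝ) (hc : 0 < c) :
    ∃ E : Set (Set (LatticeSpace d)), E.Finite ∧
      ∀ x ∈ OmegaMK M K, orbitA x ∉ E →
        ∀ Φ : Finset (R0 d), IsTight M x Φ →
          ∀ h : R0 d ≃ₗ[ℝ] R0 d, IsDistortionMap Φ h →
            ∀ S : Set (Equiv.Perm (Fin d)), IsCosetReps S →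
              (latticeIndex x Φ ≠ 0 ∧
                latticeIndex x Φ ≤ (W2 Φ h S x (radius c κ x) δ₁).ncard ∧
                (W2 Φ h S x (radius c κ x) δ₁).ncard ≤ (d - 1).factorial) ∧
              (d.Prime → latticeIndex x Φ = 1) ∧
              (W2 Φ h S x (radius c κ x) δ₁ = W1 Φ h S → latticeIndex x Φ = 1) ∧
              (d.Prime ∨ W2 Φ h S x (radius c κ x) δ₁ = W1 Φ h S →
                ((W2 Φ h S x (radius c κ x) δ₁).ncard : ℕ∞) ≤
                  ENat.card (ConnectedComponents ↥(orbitA x ∩ thick d δ₁))) := by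
  have hd0 : NeZero d := ⟨by omega⟩
  obtain ⟨C, E, hE, hmain⟩ := exists_finite_forall_isSeparated hd hM hK hδ₁ hδ₁' hκ hκ' hc
  refine ⟨E, hE, fun x hx hxE Φ hΦ h hh S hS => ?_⟩
  obtain ⟨hcov, hsep⟩ := hmain x hx hxE Φ hΦ
  obtain ⟨t, ht, hsum, hw⟩ := exists_simplex_of_isDistortionMap hcov hh
  have H := hsep t ht hsum
  have hprime : d.Prime → logStab x ≤ latticeOf Φ := H.logStab_le_of_prime
  -- Every permutation is represented modulo `Δ_Φ` by a point of `W'`, so equality of the two sets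
  -- provides a visit near each permutation.
  have hall : W2 Φ h S x (radius c κ x) δ₁ = W1 Φ h S → logStab x ≤ latticeOf Φ := by
    intro hW
    refine H.logStab_le_of_forall_visit fun π => ?_
    obtain ⟨w, hwW, hwl⟩ := H.exists_rep hw hS π
    rw [← hW] at hwW
    obtain ⟨-, b, hb, hbt⟩ := hwW
    refine ⟨w + b, hbt, _, hwl, ?_⟩
    have : w + b - (w - simplexPoint t (permVec π)) - simplexPoint t (permVec π) = b := by abel
    rw [this]
    exact (norm_le_supNorm b).trans (mul_le_mul_of_nonneg_left hb (Nat.cast_nonneg d))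
  have hone : logStab x ≤ latticeOf Φ → latticeIndex x Φ = 1 :=
    fun hle => AddSubgroup.relIndex_eq_one.2 hle
  obtain ⟨h0, hle⟩ := H.latticeIndex_le hw hS
  refine ⟨⟨h0, hle, ?_⟩, fun hp => hone (hprime hp), fun hW => hone (hall hW), fun hor => ?_⟩
  · refine (Set.ncard_le_ncard (fun _ hv => hv.1) W1_finite).trans ?_
    exact (Set.ncard_image_le (Set.toFinite S)).trans (ncard_le_of_isCosetReps hd hS)
  · exact H.ncard_le_components hw hS (hor.elim hprime hall)
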